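/- Fix a real number $1<\alpha\le 2$. Let $A_\alpha$ be the set of two-sided complex sequences $\mathbf b=(b_k)_{k\in\mathbb Z}$ with $$\sup_{n\ge 1}\ \max_{|z|=1}\ \frac{\log^{\alpha} n}{n^{\alpha-1}}\Big|\sum_{k=-n}^{n} b_k z^k\Big|<\infty .$$ Let $\mathcal W$ be the set of finite complex linear combinations of sequences of the form $(\lambda^k)_{k\in\mathbb Z}$ with $\lambda\in\mathbb C$, $|\lambda|=1$, and let $AB_\alpha$ be the set of bounded complex sequences $\mathbf a=(a_k)_{k\in\mathbb Z}$ for which there is $\mathbf w\in\mathcal W$ with $\mathbf a-\mathbf w\in A_\alpha$. Let $\mathbf a\in AB_\alpha$ be symmetric, that is, $a_k=a_{-k}$ for all $k\in\mathbb Z$. Then $\mathbf a$ is universally good for the ergodic Hilbert transform in $L_2$ for the class of weakly mixing systems. That is, for every probability space $(X,\Sigma,\mu)$, every invertible measure preserving transformation $T$ of $X$ (with $T$ and $T^{-1}$ measurable) that is weakly mixing, i.e. $$\lim_{n\to\infty}\frac1n\sum_{k=0}^{n-1}\big|\mu(T^{-k}A\cap B)-\mu(A)\mu(B)\big|=0\qquad\text{for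 all } A,B\in\Sigma,$$ and every complex-valued $f\in L_2(X,\mu)$, the limit $$\lim_{n\to\infty}\ \sum_{\substack{-n\le k\le n\\ k\ne 0}}\frac{a_k\, f(T^k x)}{k}$$ exists in $\mathbb C$ for $\mu$-almost every $x\in X$. -/

import Mathlib

open Filter Topology MeasureTheory
open scoped ENNReal

universe u

namespace ErgodicHilbert

/-- An invertible measure preserving dynamical system on a probability space. -/
structure MPSystem where
  /-- the phase space -/
  carrier : Type u
  /-- its σ-algebra -/
  [mspace : MeasurableSpace carrier]
  /-- its probability measure -/
  μ : Measure carrier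
  [prob : IsProbabilityMeasure μ]
  /-- the invertible (bimeasurable) transformation -/
  T : carrier ≃ᵐ carrier
  mp : MeasurePreserving T μ μ

attribute [instance] MPSystem.mspace MPSystem.prob

/-- The two-sided iterate `T ^ k x`, `k ∈ ℤ`. -/
def MPSystem.iter (S : MPSystem.{u}) (k : ℤ) (x : S.carrier) : S.carrier :=
  ((S.T.toEquiv : Equiv.Perm S.carrier) ^ k) x

/-- Weak mixing: the Cesàro means of `|μ(T⁻ᵏ A ∩ B) - μ(A) μ(B)|` tend to `0` for all measurable
`A` and `B`. -/
def MPSystem.WeaklyMixing (S : MPSystem.{u}) : Prop :=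
  ∀ A B : Set S.carrier, MeasurableSet A → MeasurableSet B →
    Tendsto (fun n : ℕ => (1 / (n : ℝ)) * ∑ k ∈ Finset.range n,
      |S.μ.real (S.iter (k : ℤ) ⁻¹' A ∩ B) - S.μ.real A * S.μ.real B|) atTop (𝓝 0)

/-- The class of weakly mixing measure preserving systems. -/
def weaklyMixingSystems : Set MPSystem.{u} := {S | S.WeaklyMixing}

/-- The partial sums `∑' a_k f(T ^ k x) / k` over `-n ≤ k ≤ n`, `k ≠ 0`, of the modulated ergodic
Hilbert transform. -/
noncomputable def hilbertSum (a : ℤ → ℂ) (S : MPSystem.{u}) (f : S.carrier → ℂ) (n : ℕ)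
    (x : S.carrier) : ℂ :=
  ∑ k ∈ (Finset.Icc (-(n : ℤ)) (n : ℤ)).erase 0, a k * f (S.iter k x) / (k : ℂ)

/-- `a` is good for the ergodic Hilbert transform in `L_p` of the system `S`. -/
def GoodForEHT (p : ℝ≥0∞) (a : ℤ → ℂ) (S : MPSystem.{u}) : Prop :=
  ∀ f : S.carrier → ℂ, MemLp f p S.μ →
    ∀ᵐ x ∂S.μ, ∃ l : ℂ, Tendsto (fun n : ℕ => hilbertSum a S f n x) atTop (𝓝 l)

/-- `a` is universally good for the ergodic Hilbert transform in `L_p` for the class `𝒯`. -/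
def UniversallyGoodForEHT (p : ℝ≥0∞) (a : ℤ → ℂ) (𝒯 : Set MPSystem.{u}) : Prop :=
  ∀ S ∈ 𝒯, GoodForEHT p a S

/-- Sequences induced by trigonometric polynomials: finite complex linear combinations of the
sequences `k ↦ z ^ k`, `k ∈ ℤ`, with `|z| = 1`. -/
def trigSeq : Submodule ℂ (ℤ → ℂ) :=
  Submodule.span ℂ {w | ∃ z : ℂ, ‖z‖ = 1 ∧ w = fun k : ℤ => z ^ k}

/-- The class `A_α`: the quantities `(log n) ^ α / n ^ (α - 1) * |∑_{|k| ≤ n} a_k z ^ k|` are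
bounded uniformly in `n ≥ 1` and `|z| = 1`. -/
def classA (α : ℝ) : Set (ℤ → ℂ) :=
  {a | ∃ C : ℝ, ∀ n : ℕ, 1 ≤ n → ∀ z : ℂ, ‖z‖ = 1 →
    Real.log n ^ α / (n : ℝ) ^ (α - 1) *
      ‖∑ k ∈ Finset.Icc (-(n : ℤ)) (n : ℤ), a k * z ^ k‖ ≤ C}

/-- The class `AB_α`: bounded two-sided sequences that differ from a sequence induced by a
trigonometric polynomial by a member of `A_α`. -/
def classAB (α : ℝ) : Set (ℤ → ℂ) :=
  {a | Memℓp a ∞ ∧ ∃ w ∈ trigSeq, a - w ∈ classA α}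

end ErgodicHilbert

/-! Write `a = b + w` with `b` in `classA α` and `w` in `trigSeq`. Goodness is linear in the weight,
so the two parts are treated separately.

For `w` it suffices to take one character, i.e. to prove Cotlar's theorem for the unitary `V f = w •
f ∘ T`. The symbol `H_n` of the truncated transform is bounded on the circle uniformly in `n`. If
`A_n` is the symbol of the ergodic averages, the errors `H_N - H_n - H_N A_n` along `n = 2 ^ j ≤ N`
have square sum bounded uniformly on the circle (`sum_norm_sq_error_le`). The functional calculus
turns this into a square function bound on `L²`. So `H_n f` at dyadic `n` is controlled by averages
of the single function `H_N f`, and the maximal ergodic theorem gives a weak type `(2, 2)` maximal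
inequality. By the Banach principle the functions with convergence form a closed subspace. It
contains the fixed vectors of `V` and the coboundaries `V g - g`, hence is all of `L²`
(`convergenceSubmodule_eq_top`).

For `b`, let `2 ^ j ≤ n ≤ 2 ^ (j + 1)`. The symbol of the block `2 ^ j < |k| ≤ n` of `∑ b k z ^ k /
k` is `O(1 / j ^ 2)` on the circle (`exists_norm_laurent_div_le_of_mem_classA`). The odd weight `1 /
k` forces summation by parts on each half-line separately, so the positive frequencies have to be
isolated first. This costs only a constant inside a dyadic block (`norm_sum_Ioc_le_of_annulus`). The
full blocks then sum almost everywhere. Inside a block one tests about `j ^ 2` grid points, and the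
short gaps between them are bounded trivially since `b` is bounded
(`ae_exists_forall_norm_sub_dyadic_lt`). -/

namespace ErgodicHilbert


/-! ### Functional calculus of a unitary operator -/

section Unitary

variable {H : Type*} [NormedAddCommGroup H] [InnerProductSpace ℂ H] [CompleteSpace H]

/-- The value at the unitary `V` of the Laurent polynomial `∑ k ∈ s, c k * z ^ k`. -/
noncomputable def laurentOp (V : unitary (H →L[ℂ] H)) (s : Finset ℤ) (c : ℤ → ℂ) : H →L[ℂ] H :=
  ∑ k ∈ s, c k • ((V ^ k : unitary (H →L[ℂ] H)) : H →L[ℂ] H)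

/-- The Laurent polynomial `∑ k ∈ s, c k * z ^ k`. -/
noncomputable def laurent (s : Finset ℤ) (c : ℤ → ℂ) (z : ℂ) : ℂ := ∑ k ∈ s, c k * z ^ k

theorem continuousOn_laurent (s : Finset ℤ) (c : ℤ → ℂ) :
    ContinuousOn (laurent s c) (Metric.sphere 0 1) := by
  unfold laurent
  refine continuousOn_finsetSum _ fun k _ => continuousOn_const.mul ?_
  exact fun z hz => (continuousAt_zpow₀ z k (Or.inl (by
    rintro rfl; simp at hz))).continuousWithinAt

theorem spectrum_subset_sphere (V : unitary (H →L[ℂ] H)) :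
    spectrum ℂ (V : H →L[ℂ] H) ⊆ Metric.sphere 0 1 :=
  spectrum.subset_circle_of_unitary V.2

theorem cfc_zpow_unitary (V : unitary (H →L[ℂ] H)) (k : ℤ) :
    cfc (fun z : ℂ => z ^ k) (V : H →L[ℂ] H) = ((V ^ k : unitary (H →L[ℂ] H)) : H →L[ℂ] H) := by
  have h := cfc_zpow (R := ℂ) (Unitary.toUnits V) k
    (by simpa using (inferInstance : IsStarNormal (V : H →L[ℂ] H)))
  rw [← map_zpow] at h
  exact h

/-- The spectrum of a unitary lies on the unit circle, so operator bounds for Laurent polynomials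
reduce to sup bounds of their symbols there. -/
theorem laurentOp_eq_cfc (V : unitary (H →L[ℂ] H)) (s : Finset ℤ) (c : ℤ → ℂ) :
    laurentOp V s c = cfc (laurent s c) (V : H →L[ℂ] H) := by
  have hc : ∀ k : ℤ, ContinuousOn (fun z : ℂ => z ^ k) (spectrum ℂ (V : H →L[ℂ] H)) := fun k => by
    refine ContinuousOn.mono ?_ (spectrum_subset_sphere V)
    exact fun z hz => (continuousAt_zpow₀ z k (Or.inl (by
      rintro rfl; simp at hz))).continuousWithinAt
  have : laurent s c = ∑ k ∈ s, fun z : ℂ => c k * z ^ k := by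
    ext z; simp [laurent]
  rw [this, cfc_sum (fun k (z : ℂ) => c k * z ^ k) _ _ (fun k _ => continuousOn_const.mul (hc k))]
  refine Finset.sum_congr rfl fun k _ => ?_
  rw [cfc_const_mul _ _ _ (hc k), cfc_zpow_unitary]

/-- Square function estimate: a family of functions of a unitary with bounded square sum. -/
theorem sum_norm_sq_cfc_le {ι : Type*} (V : unitary (H →L[ℂ] H)) (s : Finset ι) (g : ι → ℂ → ℂ)
    (hg : ∀ i ∈ s, ContinuousOn (g i) (Metric.sphere 0 1)) {D : ℝ} (hD : 0 ≤ D)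
    (h : ∀ z : ℂ, ‖z‖ = 1 → ∑ i ∈ s, ‖g i z‖ ^ 2 ≤ D) (f : H) :
    ∑ i ∈ s, ‖cfc (g i) (V : H →L[ℂ] H) f‖ ^ 2 ≤ D * ‖f‖ ^ 2 := by
  have hsp := spectrum_subset_sphere V
  have hg' : ∀ i ∈ s, ContinuousOn (g i) (spectrum ℂ (V : H →L[ℂ] H)) :=
    fun i hi => (hg i hi).mono hsp
  -- The square sum equals `⟨f, A f⟩`, where `A` is the value at `V` of the scalar function `∑ |g i|
  -- ^ 2`; hence `‖A‖ ≤ D`.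
  set A : H →L[ℂ] H := ∑ i ∈ s, star (cfc (g i) (V : H →L[ℂ] H)) * cfc (g i) (V : H →L[ℂ] H)
    with hA
  have hA' : A = cfc (∑ i ∈ s, fun z => star (g i z) * g i z) (V : H →L[ℂ] H) := by
    rw [hA, cfc_sum (fun i (z : ℂ) => star (g i z) * g i z) _ _
      (fun i hi => ((hg' i hi).star.mul (hg' i hi)))]
    refine Finset.sum_congr rfl fun i hi => ?_
    rw [cfc_mul _ _ _ (hg' i hi).star (hg' i hi), cfc_star]
  have hn : ‖A‖ ≤ D := by
    rw [hA']
    refine norm_cfc_le hD fun z hz => ?_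
    have hz1 : ‖z‖ = 1 := by simpa using hsp hz
    rw [Finset.sum_apply]
    refine (norm_sum_le _ _).trans (le_trans (le_of_eq ?_) (h z hz1))
    refine Finset.sum_congr rfl fun i _ => ?_
    rw [norm_mul, norm_star, sq]
  have key : ((∑ i ∈ s, ‖cfc (g i) (V : H →L[ℂ] H) f‖ ^ 2 : ℝ) : ℂ) = inner ℂ f (A f) := by
    rw [hA, sum_apply, inner_sum]
    push_cast
    refine Finset.sum_congr rfl fun i _ => ?_
    rw [ContinuousLinearMap.star_eq_adjoint, Function.comp_apply,
      ContinuousLinearMap.adjoint_inner_right, inner_self_eq_norm_sq_to_K]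
    rfl
  have h1 : ‖inner ℂ f (A f)‖ ≤ D * ‖f‖ ^ 2 := by
    refine (norm_inner_le_norm _ _).trans ?_
    have := A.le_opNorm f
    nlinarith [norm_nonneg f, mul_le_mul_of_nonneg_right hn (norm_nonneg f)]
  rw [← key, Complex.norm_real, Real.norm_eq_abs] at h1
  exact (le_abs_self _).trans h1

theorem norm_cfc_apply_le (V : unitary (H →L[ℂ] H)) (g : ℂ → ℂ)
    (hg : ContinuousOn g (Metric.sphere 0 1)) {D : ℝ} (hD : 0 ≤ D)
    (h : ∀ z : ℂ, ‖z‖ = 1 → ‖g z‖ ≤ D) (f : H) :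
    ‖cfc g (V : H →L[ℂ] H) f‖ ≤ D * ‖f‖ := by
  have := sum_norm_sq_cfc_le V (Finset.univ : Finset Unit) (fun _ => g) (fun _ _ => hg)
    (sq_nonneg D) (fun z hz => by simpa using pow_le_pow_left₀ (norm_nonneg _) (h z hz) 2) f
  simp only [Finset.univ_unique, Finset.sum_singleton, ← mul_pow] at this
  exact le_of_sq_le_sq this (by positivity)

theorem norm_laurentOp_apply_le (V : unitary (H →L[ℂ] H)) (s : Finset ℤ) (c : ℤ → ℂ) {D : ℝ}
    (hD : 0 ≤ D) (h : ∀ z : ℂ, ‖z‖ = 1 → ‖laurent s c z‖ ≤ D) (f : H) :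
    ‖laurentOp V s c f‖ ≤ D * ‖f‖ := by
  rw [laurentOp_eq_cfc]
  exact norm_cfc_apply_le V _ (continuousOn_laurent s c) hD h f

theorem norm_unitary_apply (V : unitary (H →L[ℂ] H)) (f : H) : ‖(V : H →L[ℂ] H) f‖ = ‖f‖ :=
  ContinuousLinearMap.norm_map_of_mem_unitary V.2 f

end Unitary


/-! ### Symmetric frequency ranges and summation by parts -/

/-- The integers `k` with `m < |k| ≤ n`. -/
def annulus (m n : ℕ) : Finset ℤ :=
  (Finset.Ioc m n).image (fun k : ℕ => (k : ℤ)) ∪ (Finset.Ioc m n).image (fun k : ℕ => -(k : ℤ))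

theorem mem_annulus {m n : ℕ} {k : ℤ} : k ∈ annulus m n ↔ m < k.natAbs ∧ k.natAbs ≤ n := by
  simp only [annulus, Finset.mem_union, Finset.mem_image, Finset.mem_Ioc]
  constructor
  · rintro (⟨i, hi, rfl⟩ | ⟨i, hi, rfl⟩) <;> omega
  · intro h
    rcases le_total 0 k with hk | hk
    · exact Or.inl ⟨k.natAbs, h, by omega⟩
    · exact Or.inr ⟨k.natAbs, h, by omega⟩

theorem sum_annulus {M : Type*} [AddCommMonoid M] (m n : ℕ) (F : ℤ → M) :
    ∑ k ∈ annulus m n, F k = ∑ k ∈ Finset.Ioc m n, (F k + F (-k)) := by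
  rw [annulus, Finset.sum_union, Finset.sum_image, Finset.sum_image, Finset.sum_add_distrib]
  · intro a _ b _ h; simpa using h
  · intro a _ b _ h; simpa using h
  · rw [Finset.disjoint_left]
    simp only [Finset.mem_image, Finset.mem_Ioc]
    rintro _ ⟨i, hi, rfl⟩ ⟨j, hj, h⟩
    omega

theorem Icc_erase_zero (n : ℕ) : (Finset.Icc (-(n : ℤ)) n).erase 0 = annulus 0 n := by
  ext k
  rw [mem_annulus, Finset.mem_erase, Finset.mem_Icc]
  omega

theorem sum_annulus_add {M : Type*} [AddCommMonoid M] {l m n : ℕ} (hlm : l ≤ m) (hmn : m ≤ n)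
    (F : ℤ → M) :
    ∑ k ∈ annulus l m, F k + ∑ k ∈ annulus m n, F k = ∑ k ∈ annulus l n, F k := by
  simp only [sum_annulus]
  exact Finset.sum_Ioc_consecutive _ hlm hmn

/-- Summation by parts for weights `1 / k`. -/
theorem norm_sum_Ioc_div_le {x : ℕ → ℂ} {m n : ℕ} {D : ℝ} (hmn : m ≤ n)
    (h : ∀ i, m ≤ i → i ≤ n → ‖∑ k ∈ Finset.Ioc m i, x k‖ ≤ D) :
    ‖∑ k ∈ Finset.Ioc m n, x k / k‖ ≤ D / (m + 1) := by
  -- With the boundary term of the Abel summation removed, the bound telescopes. Adding that term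
  -- back at the end costs exactly `D / (n + 1)`.
  have key : ‖∑ k ∈ Finset.Ioc m n, x k / k - (∑ k ∈ Finset.Ioc m n, x k) / (n + 1)‖ ≤
      D * (1 / (m + 1) - 1 / (n + 1)) := by
    induction n, hmn using Nat.le_induction with
    | base => simp
    | succ n hmn ih =>
      have ih' := ih fun i hi hin => h i hi (by omega)
      set X := ∑ k ∈ Finset.Ioc m (n + 1), x k with hX
      have hX' : ∑ k ∈ Finset.Ioc m n, x k = X - x (n + 1) := by
        rw [hX, Finset.sum_Ioc_succ_top (by omega)]; ring
      rw [Finset.sum_Ioc_succ_top (by omega)]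
      rw [hX'] at ih'
      have hXn : ‖X‖ ≤ D := h (n + 1) (by omega) le_rfl
      have hn1 : ((n : ℂ) + 1) ≠ 0 := by exact_mod_cast Nat.succ_ne_zero n
      have hn2 : ((n : ℂ) + 1 + 1) ≠ 0 := by exact_mod_cast Nat.succ_ne_zero (n + 1)
      have hr : ‖X * (((1 / (n + 1) - 1 / (n + 1 + 1) : ℝ)) : ℂ)‖ ≤
          D * (1 / (n + 1) - 1 / (n + 1 + 1)) := by
        have h0 : (0 : ℝ) ≤ 1 / (n + 1) - 1 / (n + 1 + 1) := by
          rw [sub_nonneg]; gcongr; linarith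
        rw [norm_mul, Complex.norm_real, Real.norm_of_nonneg h0]
        gcongr
      refine le_trans (le_of_eq_of_le ?_ ((norm_add_le _ _).trans (add_le_add ih' hr))) ?_
      · congr 1
        push_cast
        field_simp
        ring
      · push_cast
        exact le_of_eq (by ring)
  have hD : ‖(∑ k ∈ Finset.Ioc m n, x k) / ((n : ℂ) + 1)‖ ≤ D * (1 / (n + 1)) := by
    have : ‖((n : ℂ) + 1)‖ = n + 1 := by
      exact_mod_cast Complex.norm_natCast (n + 1)
    rw [norm_div, this, mul_one_div]
    gcongr
    exact h n hmn le_rfl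
  calc _ = ‖(∑ k ∈ Finset.Ioc m n, x k / k - (∑ k ∈ Finset.Ioc m n, x k) / (n + 1)) +
        (∑ k ∈ Finset.Ioc m n, x k) / (n + 1)‖ := by rw [sub_add_cancel]
    _ ≤ _ := norm_add_le _ _
    _ ≤ D * (1 / (m + 1) - 1 / (n + 1)) + D * (1 / (n + 1)) := add_le_add key hD
    _ = D / (m + 1) := by ring

/-! ### Symbols of the Hilbert transform and of the averages on the circle -/

theorem norm_one_sub_mul_geom_Ioc_le {z : ℂ} (hz : ‖z‖ = 1) {m n : ℕ} (hmn : m ≤ n) :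
    ‖1 - z‖ * ‖∑ k ∈ Finset.Ioc m n, z ^ k‖ ≤ 2 := by
  have : (1 - z) * ∑ k ∈ Finset.Ioc m n, z ^ k = z ^ (m + 1) - z ^ (n + 1) := by
    induction n, hmn using Nat.le_induction with
    | base => simp
    | succ n hmn ih => rw [Finset.sum_Ioc_succ_top (by omega), mul_add, ih]; ring
  rw [← norm_mul, this]
  refine (norm_sub_le _ _).trans ?_
  simp [hz]; norm_num

theorem norm_one_sub_pow_le {z : ℂ} (hz : ‖z‖ = 1) (k : ℕ) : ‖1 - z ^ k‖ ≤ k * ‖1 - z‖ := by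
  induction k with
  | zero => simp
  | succ k ih =>
    have : 1 - z ^ (k + 1) = (1 - z ^ k) + z ^ k * (1 - z) := by ring
    rw [this]
    refine (norm_add_le _ _).trans ?_
    rw [norm_mul, norm_pow, hz, one_pow]
    push_cast
    linarith

theorem norm_one_sub_inv {z : ℂ} (hz : ‖z‖ = 1) : ‖1 - z⁻¹‖ = ‖1 - z‖ := by
  have h0 : z ≠ 0 := by rintro rfl; simp at hz
  have : 1 - z⁻¹ = -(z⁻¹ * (1 - z)) := by field_simp; ring
  rw [this, norm_neg, norm_mul, norm_inv, hz]; simp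

/-- The symbol `∑ 0 < |k| ≤ n, z ^ k / k` of the truncated Hilbert transform. -/
noncomputable def hilbertSymbol (n : ℕ) (z : ℂ) : ℂ :=
  laurent (annulus 0 n) (fun k => 1 / (k : ℂ)) z

/-- The symbol `n⁻¹ * ∑ k < n, z ^ k` of the ergodic averages. -/
noncomputable def averageSymbol (n : ℕ) (z : ℂ) : ℂ :=
  laurent ((Finset.range n).image fun k : ℕ => (k : ℤ)) (fun _ => 1 / (n : ℂ)) z

theorem hilbertSymbol_eq (n : ℕ) (z : ℂ) :
    hilbertSymbol n z = ∑ k ∈ Finset.Ioc 0 n, (z ^ k - z⁻¹ ^ k) / (k : ℂ) := by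
  rw [hilbertSymbol, laurent, sum_annulus]
  refine Finset.sum_congr rfl fun k _ => ?_
  push_cast
  rw [zpow_neg, zpow_natCast, inv_pow, div_neg]
  ring

theorem averageSymbol_eq (n : ℕ) (z : ℂ) :
    averageSymbol n z = 1 / (n : ℂ) * ∑ k ∈ Finset.range n, z ^ k := by
  rw [averageSymbol, laurent, Finset.sum_image (fun a _ b _ h => by simpa using h), Finset.mul_sum]
  simp

theorem norm_hilbertSymbol_le_mul {z : ℂ} (hz : ‖z‖ = 1) (n : ℕ) :
    ‖hilbertSymbol n z‖ ≤ 2 * (n * ‖1 - z‖) := by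
  rw [hilbertSymbol_eq]
  refine (norm_sum_le _ _).trans ?_
  have : ∀ k ∈ Finset.Ioc 0 n, ‖(z ^ k - z⁻¹ ^ k) / (k : ℂ)‖ ≤ 2 * ‖1 - z‖ := by
    intro k hk
    have hk0 : (0 : ℝ) < k := by exact_mod_cast (Finset.mem_Ioc.1 hk).1
    rw [norm_div, Complex.norm_natCast, div_le_iff₀ hk0]
    have h1 := norm_one_sub_pow_le hz k
    have h2 := norm_one_sub_pow_le (z := z⁻¹) (by simp [hz]) k
    rw [norm_one_sub_inv hz] at h2
    calc ‖z ^ k - z⁻¹ ^ k‖ = ‖(1 - z⁻¹ ^ k) - (1 - z ^ k)‖ := by congr 1; ring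
      _ ≤ _ := norm_sub_le _ _
      _ ≤ _ := by linarith
  refine (Finset.sum_le_card_nsmul _ _ _ this).trans (le_of_eq ?_)
  rw [Nat.card_Ioc, nsmul_eq_mul, Nat.sub_zero]; ring

theorem mul_norm_hilbertSymbol_sub_le {z : ℂ} (hz : ‖z‖ = 1) {n N : ℕ} (hn : n ≤ N) :
    (n + 1) * ‖1 - z‖ * ‖hilbertSymbol N z - hilbertSymbol n z‖ ≤ 4 := by
  rcases (norm_nonneg (1 - z)).eq_or_lt with h0 | h0
  · rw [← h0]; simp
  have hz' : ‖z⁻¹‖ = 1 := by simp [hz]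
  have geom : ∀ {w : ℂ}, ‖w‖ = 1 → ‖1 - w‖ = ‖1 - z‖ →
      ‖∑ k ∈ Finset.Ioc n N, w ^ k / (k : ℂ)‖ ≤ 2 / ‖1 - z‖ / (n + 1) := by
    intro w hw hwz
    refine norm_sum_Ioc_div_le hn fun i hi _ => ?_
    rw [le_div_iff₀ h0, mul_comm, ← hwz]
    exact norm_one_sub_mul_geom_Ioc_le hw hi
  have e : hilbertSymbol N z - hilbertSymbol n z =
      ∑ k ∈ Finset.Ioc n N, z ^ k / (k : ℂ) - ∑ k ∈ Finset.Ioc n N, z⁻¹ ^ k / (k : ℂ) := by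
    rw [hilbertSymbol_eq, hilbertSymbol_eq, ← Finset.sum_Ioc_consecutive _ (Nat.zero_le n) hn,
      add_sub_cancel_left, ← Finset.sum_sub_distrib]
    exact Finset.sum_congr rfl fun k _ => sub_div _ _ _
  have hle : ‖hilbertSymbol N z - hilbertSymbol n z‖ ≤ 4 / ((n + 1) * ‖1 - z‖) := by
    rw [e]
    refine (norm_sub_le _ _).trans ((add_le_add (geom hz rfl)
      (geom hz' (norm_one_sub_inv hz))).trans (le_of_eq ?_))
    field_simp; norm_num
  have hpos : (0 : ℝ) < (n + 1) * ‖1 - z‖ := by positivity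
  rw [le_div_iff₀ hpos] at hle
  linarith

/-- Cut the sum at `n ≈ 1 / ‖1 - z‖`. Below the cut, `|z ^ k - z⁻¹ ^ k| ≤ 2 k ‖1 - z‖` contributes
at most `2`; beyond it, cancellation in the geometric sums contributes at most `4`. -/
theorem norm_hilbertSymbol_le {z : ℂ} (hz : ‖z‖ = 1) (N : ℕ) : ‖hilbertSymbol N z‖ ≤ 6 := by
  rcases (norm_nonneg (1 - z)).eq_or_lt with h0 | h0
  · have := norm_hilbertSymbol_le_mul hz N
    rw [← h0] at this; linarith
  set n := ⌊1 / ‖1 - z‖⌋₊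
  have h1 : n * ‖1 - z‖ ≤ 1 := by
    rw [← le_div_iff₀ h0]; exact Nat.floor_le (by positivity)
  have h2 : 1 ≤ (n + 1) * ‖1 - z‖ := by
    rw [← div_le_iff₀ h0]; exact (Nat.lt_floor_add_one _).le
  rcases le_total N n with hN | hN
  · have h3 : (N : ℝ) ≤ n := by exact_mod_cast hN
    have := norm_hilbertSymbol_le_mul hz N
    nlinarith
  · have h3 := norm_hilbertSymbol_le_mul hz n
    have h4 := mul_norm_hilbertSymbol_sub_le hz hN
    have h5 : ‖hilbertSymbol N z - hilbertSymbol n z‖ ≤ 4 :=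
      le_trans (le_mul_of_one_le_left (norm_nonneg _) h2) h4
    have h6 : ‖hilbertSymbol N z‖ ≤ ‖hilbertSymbol N z - hilbertSymbol n z‖ + ‖hilbertSymbol n z‖ := by
      simpa using norm_add_le (hilbertSymbol N z - hilbertSymbol n z) (hilbertSymbol n z)
    linarith

theorem norm_one_sub_averageSymbol_le {z : ℂ} (hz : ‖z‖ = 1) {n : ℕ} (hn : 0 < n) :
    ‖1 - averageSymbol n z‖ ≤ n * ‖1 - z‖ := by
  have hn' : (0 : ℝ) < n := by exact_mod_cast hn
  have hnc : (n : ℂ) ≠ 0 := by exact_mod_cast hn.ne'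
  have e : 1 - averageSymbol n z = 1 / (n : ℂ) * ∑ k ∈ Finset.range n, (1 - z ^ k) := by
    rw [averageSymbol_eq, Finset.sum_sub_distrib]
    simp [mul_sub, hnc]
  rw [e, norm_mul, norm_div, Complex.norm_natCast, norm_one, one_div_mul_eq_div,
    div_le_iff₀ hn']
  refine (norm_sum_le _ _).trans ?_
  have : ∀ k ∈ Finset.range n, ‖1 - z ^ k‖ ≤ n * ‖1 - z‖ := by
    intro k hk
    have : (k : ℝ) ≤ n := by exact_mod_cast (Finset.mem_range.1 hk).le
    refine (norm_one_sub_pow_le hz k).trans (by gcongr)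
  refine (Finset.sum_le_card_nsmul _ _ _ this).trans (le_of_eq ?_)
  rw [Finset.card_range, nsmul_eq_mul]; ring

theorem mul_norm_averageSymbol_le {z : ℂ} (hz : ‖z‖ = 1) (n : ℕ) :
    n * ‖1 - z‖ * ‖averageSymbol n z‖ ≤ 2 := by
  rcases Nat.eq_zero_or_pos n with rfl | hn
  · simp
  have hn' : (0 : ℝ) < n := by exact_mod_cast hn
  have e : (1 - z) * ∑ k ∈ Finset.range n, z ^ k = 1 - z ^ n := by
    have := geom_sum_mul z n
    linear_combination -this
  rw [averageSymbol_eq, norm_mul, norm_div, Complex.norm_natCast, norm_one]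
  calc n * ‖1 - z‖ * (1 / n * ‖∑ k ∈ Finset.range n, z ^ k‖)
      = ‖(1 - z) * ∑ k ∈ Finset.range n, z ^ k‖ := by rw [norm_mul]; field_simp
    _ ≤ ‖(1 : ℂ)‖ + ‖z ^ n‖ := by rw [e]; exact norm_sub_le _ _
    _ = 2 := by rw [norm_pow, hz]; norm_num

/-- With `a = n ‖1 - z‖`, the error is `O(a)` because `A_n` is close to `1` and `H_n` to `0`, and
`O(1 / a)` because `A_n` is small and `H_n` is close to `H_N`. Its square is thus `O(min (a ^ 2) (a
^ (-2)))`, the size of the increment of `t ^ 2 / (1 + t ^ 2)` from `a` to `2 a`. This form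
telescopes along powers of two. -/
theorem norm_sq_error_le {z : ℂ} (hz : ‖z‖ = 1) {n N : ℕ} (hn : 0 < n) (hnN : n ≤ N) :
    ‖hilbertSymbol N z - hilbertSymbol n z - hilbertSymbol N z * averageSymbol n z‖ ^ 2 ≤
      576 * ((2 * n * ‖1 - z‖) ^ 2 / (1 + (2 * n * ‖1 - z‖) ^ 2) -
        (n * ‖1 - z‖) ^ 2 / (1 + (n * ‖1 - z‖) ^ 2)) := by
  set E := hilbertSymbol N z - hilbertSymbol n z - hilbertSymbol N z * averageSymbol n z with hE
  set a : ℝ := n * ‖1 - z‖ with ha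
  have ha0 : 0 ≤ a := by positivity
  have h1 := norm_hilbertSymbol_le_mul hz n
  have h2 := mul_norm_hilbertSymbol_sub_le hz hnN
  have h3 := norm_hilbertSymbol_le hz N
  have h4 := norm_one_sub_averageSymbol_le hz hn
  have h5 := mul_norm_averageSymbol_le hz n
  have e1 : ‖E‖ ≤ 8 * a := by
    have : E = hilbertSymbol N z * (1 - averageSymbol n z) - hilbertSymbol n z := by rw [hE]; ring
    rw [this]
    refine (norm_sub_le _ _).trans ?_
    rw [norm_mul]
    nlinarith [mul_le_mul h3 h4 (norm_nonneg _) (by norm_num)]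
  have e2 : a * ‖E‖ ≤ 16 := by
    have h6 : ‖E‖ ≤ ‖hilbertSymbol N z - hilbertSymbol n z‖ + ‖hilbertSymbol N z‖ *
        ‖averageSymbol n z‖ := by
      rw [← norm_mul]; exact norm_sub_le _ _
    have h7 : a * ‖hilbertSymbol N z - hilbertSymbol n z‖ ≤ 4 := by
      refine le_trans ?_ h2
      rw [ha]; gcongr; linarith
    have h8 : a * (‖hilbertSymbol N z‖ * ‖averageSymbol n z‖) ≤ 6 * 2 := by
      rw [mul_left_comm]
      exact mul_le_mul h3 h5 (by positivity) (by norm_num)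
    nlinarith [mul_le_mul_of_nonneg_left h6 ha0]
  have hb : (2 * n * ‖1 - z‖) = 2 * a := by rw [ha]; ring
  rw [hb]
  have hd : (2 * a) ^ 2 / (1 + (2 * a) ^ 2) - a ^ 2 / (1 + a ^ 2) =
      3 * a ^ 2 / ((1 + 4 * a ^ 2) * (1 + a ^ 2)) := by
    field_simp; ring
  rw [hd, ← mul_div_assoc, le_div_iff₀ (by positivity)]
  -- The three bounds match the terms of `(1 + 4 a ^ 2)(1 + a ^ 2) = 1 + 5 a ^ 2 + 4 a ^ 4`: `64 + 5
  -- * 128 + 4 * 256 = 3 * 576`.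
  have q1 : ‖E‖ ^ 2 ≤ 64 * a ^ 2 := by nlinarith [norm_nonneg E]
  have q2 : ‖E‖ ^ 2 ≤ 128 := by nlinarith [norm_nonneg E]
  have q3 : a ^ 2 * ‖E‖ ^ 2 ≤ 256 := by nlinarith [norm_nonneg E, mul_nonneg ha0 (norm_nonneg E)]
  nlinarith [mul_le_mul_of_nonneg_left q2 (sq_nonneg a), mul_le_mul_of_nonneg_left q3 (sq_nonneg a)]

/-- The increments telescope to a difference of values of `t ^ 2 / (1 + t ^ 2)`, which lie in `[0,
1]`. -/
theorem sum_norm_sq_error_le {z : ℂ} (hz : ‖z‖ = 1) {J N : ℕ} (hJ : 2 ^ J ≤ N) :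
    ∑ j ∈ Finset.range (J + 1), ‖hilbertSymbol N z - hilbertSymbol (2 ^ j) z -
      hilbertSymbol N z * averageSymbol (2 ^ j) z‖ ^ 2 ≤ 576 := by
  set F : ℕ → ℝ := fun j => ((2 : ℝ) ^ j * ‖1 - z‖) ^ 2 / (1 + ((2 : ℝ) ^ j * ‖1 - z‖) ^ 2)
  have h : ∀ j ∈ Finset.range (J + 1), ‖hilbertSymbol N z - hilbertSymbol (2 ^ j) z -
      hilbertSymbol N z * averageSymbol (2 ^ j) z‖ ^ 2 ≤ 576 * (F (j + 1) - F j) := by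
    intro j hj
    have hjJ : j ≤ J := by have := Finset.mem_range.1 hj; omega
    have := norm_sq_error_le hz (n := 2 ^ j) (N := N) (by positivity)
      ((Nat.pow_le_pow_right (by norm_num) hjJ).trans hJ)
    push_cast at this
    simpa [F, pow_succ'] using this
  refine (Finset.sum_le_sum h).trans ?_
  rw [← Finset.mul_sum, Finset.sum_range_sub]
  have h1 : F (J + 1) ≤ 1 := by
    rw [div_le_one (by positivity)]; linarith
  have h0 : 0 ≤ F 0 := by positivity
  linarith


/-! ### Separating positive and negative frequencies -/

open Complex in
theorem integral_exp_zpow (k : ℤ) :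
    ∫ θ in (0 : ℝ)..2 * Real.pi, (exp (θ * I)) ^ k = if k = 0 then 2 * (Real.pi : ℂ) else 0 := by
  split_ifs with h
  · simp [h]
  · have hk : (k * I : ℂ) ≠ 0 := mul_ne_zero (by exact_mod_cast h) I_ne_zero
    have e : ∀ θ : ℝ, exp (θ * I) ^ k = exp (k * I * θ) := fun θ => by
      rw [← exp_int_mul]; congr 1; ring
    simp_rw [e]
    rw [integral_exp_mul_complex hk]
    have : exp (k * I * (2 * Real.pi : ℝ)) = 1 := by
      rw [exp_eq_one_iff]; exact ⟨k, by push_cast; ring⟩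
    rw [this]
    simp

theorem continuous_laurent_exp (s : Finset ℤ) (c : ℤ → ℂ) (z : ℂ) (hz : ‖z‖ = 1) :
    Continuous fun θ : ℝ => laurent s c (z * Complex.exp (θ * Complex.I)) := by
  refine (continuousOn_laurent s c).comp_continuous (by fun_prop) fun θ => ?_
  simp [hz, Complex.norm_exp_ofReal_mul_I]

theorem conj_laurent_one {w : ℂ} (hw : ‖w‖ = 1) (s : Finset ℤ) :
    (starRingEnd ℂ) (laurent s 1 w) = ∑ l ∈ s, w ^ (-l) := by
  simp only [laurent, Pi.one_apply, one_mul, map_sum, map_zpow₀]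
  refine Finset.sum_congr rfl fun l _ => ?_
  rw [← Complex.inv_eq_conj hw, inv_zpow, zpow_neg]

theorem intervalIntegrable_exp_zpow (k : ℤ) (c : ℂ) :
    IntervalIntegrable (fun θ : ℝ => c * (Complex.exp (θ * Complex.I)) ^ k) volume 0
      (2 * Real.pi) := by
  refine Continuous.intervalIntegrable ?_ _ _
  refine continuous_const.mul (Continuous.zpow₀ (by fun_prop) k fun θ => Or.inl (Complex.exp_ne_zero _))

theorem intervalIntegrable_finsetSum {ι : Type*} {s : Finset ι} {f : ι → ℝ → ℂ} {a b : ℝ}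
    (h : ∀ i ∈ s, IntervalIntegrable (f i) volume a b) :
    IntervalIntegrable (fun θ => ∑ i ∈ s, f i θ) volume a b := by
  have := IntervalIntegrable.sum s h
  rwa [Finset.sum_fn] at this

theorem integral_norm_sq_laurent_one (s : Finset ℤ) :
    ∫ θ in (0 : ℝ)..2 * Real.pi, ‖laurent s 1 (Complex.exp (θ * Complex.I))‖ ^ 2 =
      2 * Real.pi * s.card := by
  have e : ∀ θ : ℝ, ((‖laurent s 1 (Complex.exp (θ * Complex.I))‖ ^ 2 : ℝ) : ℂ) =
      ∑ l ∈ s, ∑ l' ∈ s, 1 * (Complex.exp (θ * Complex.I)) ^ (l - l') := by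
    intro θ
    have hw : ‖Complex.exp (θ * Complex.I)‖ = 1 := Complex.norm_exp_ofReal_mul_I θ
    push_cast
    rw [← Complex.mul_conj', conj_laurent_one hw, laurent, Finset.sum_mul_sum]
    refine Finset.sum_congr rfl fun l _ => Finset.sum_congr rfl fun l' _ => ?_
    rw [sub_eq_add_neg, zpow_add₀ (Complex.exp_ne_zero _)]
    simp
  have : ((∫ θ in (0 : ℝ)..2 * Real.pi, ‖laurent s 1 (Complex.exp (θ * Complex.I))‖ ^ 2 : ℝ) : ℂ)
      = 2 * Real.pi * s.card := by
    rw [← intervalIntegral.integral_ofReal]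
    simp_rw [e]
    rw [intervalIntegral.integral_finsetSum
      (fun l _ => intervalIntegrable_finsetSum fun l' _ => intervalIntegrable_exp_zpow (l - l') 1)]
    have : ∀ l ∈ s, ∫ θ in (0 : ℝ)..2 * Real.pi, ∑ l' ∈ s,
        1 * (Complex.exp (θ * Complex.I)) ^ (l - l') = 2 * Real.pi := by
      intro l hl
      rw [intervalIntegral.integral_finsetSum (fun l' _ => intervalIntegrable_exp_zpow _ _)]
      simp_rw [one_mul, integral_exp_zpow, sub_eq_zero]
      simp [hl]
    rw [Finset.sum_congr rfl this]
    simp [mul_comm]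
  exact_mod_cast this

/-- Multiplying the coefficients of a Laurent polynomial by the correlation `#(B ∩ (A + k))` of two
finite sets changes its maximum over the unit circle at most by the factor `(#A + #B) / 2`. -/
theorem norm_sum_correlation_le (s A B : Finset ℤ) (c : ℤ → ℂ) {D : ℝ}
    (h : ∀ z : ℂ, ‖z‖ = 1 → ‖laurent s c z‖ ≤ D) {z : ℂ} (hz : ‖z‖ = 1) :
    ‖∑ k ∈ s, c k * z ^ k * ((A.filter fun l => k + l ∈ B).card : ℂ)‖ ≤
      D * ((A.card + B.card) / 2) := by
  have hz0 : z ≠ 0 := by rintro rfl; simp at hz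
  set w : ℝ → ℂ := fun θ => Complex.exp (θ * Complex.I) with hw
  have hw1 : ∀ θ, ‖w θ‖ = 1 := fun θ => Complex.norm_exp_ofReal_mul_I θ
  have hw0 : ∀ θ, w θ ≠ 0 := fun θ => Complex.exp_ne_zero _
  -- By orthogonality, the mean of `G` picks out the triples with `k + l = l'`, which is the
  -- correlation sum. The factor `(#A + #B) / 2` comes from `p q ≤ (p ^ 2 + q ^ 2) / 2` and
  -- Parseval.
  set G : ℝ → ℂ := fun θ => laurent s c (z * w θ) * (laurent A 1 (w θ) *
    (starRingEnd ℂ) (laurent B 1 (w θ))) with hG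
  have cA : Continuous fun θ : ℝ => laurent A 1 (w θ) := by
    simpa using continuous_laurent_exp A 1 1 (by simp)
  have cB : Continuous fun θ : ℝ => laurent B 1 (w θ) := by
    simpa using continuous_laurent_exp B 1 1 (by simp)
  have e : ∀ θ, G θ = ∑ k ∈ s, ∑ l ∈ A, ∑ l' ∈ B, (c k * z ^ k) * w θ ^ (k + l - l') := by
    intro θ
    simp only [hG]
    rw [conj_laurent_one (hw1 θ), laurent, Finset.sum_mul]
    refine Finset.sum_congr rfl fun k _ => ?_
    rw [laurent, Finset.sum_mul_sum, Finset.mul_sum]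
    refine Finset.sum_congr rfl fun l _ => ?_
    rw [Finset.mul_sum]
    refine Finset.sum_congr rfl fun l' _ => ?_
    rw [sub_eq_add_neg, zpow_add₀ (hw0 θ), zpow_add₀ (hw0 θ), mul_zpow]
    simp only [Pi.one_apply]
    ring
  have hint : ∫ θ in (0 : ℝ)..2 * Real.pi, G θ =
      2 * Real.pi * ∑ k ∈ s, c k * z ^ k * ((A.filter fun l => k + l ∈ B).card : ℂ) := by
    simp_rw [e]
    have i1 : ∀ k l, IntervalIntegrable (fun θ : ℝ => ∑ l' ∈ B, (c k * z ^ k) *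
        w θ ^ (k + l - l')) volume 0 (2 * Real.pi) := fun k l =>
      intervalIntegrable_finsetSum fun l' _ => intervalIntegrable_exp_zpow _ _
    have i2 : ∀ k, IntervalIntegrable (fun θ : ℝ => ∑ l ∈ A, ∑ l' ∈ B, (c k * z ^ k) *
        w θ ^ (k + l - l')) volume 0 (2 * Real.pi) := fun k =>
      intervalIntegrable_finsetSum fun l _ => i1 k l
    rw [intervalIntegral.integral_finsetSum fun k _ => i2 k, Finset.mul_sum]
    refine Finset.sum_congr rfl fun k _ => ?_
    rw [intervalIntegral.integral_finsetSum fun l _ => i1 k l, Finset.card_filter]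
    push_cast
    rw [Finset.mul_sum, Finset.mul_sum]
    refine Finset.sum_congr rfl fun l _ => ?_
    rw [intervalIntegral.integral_finsetSum fun l' _ => intervalIntegrable_exp_zpow _ _]
    simp_rw [intervalIntegral.integral_const_mul, integral_exp_zpow, sub_eq_zero]
    by_cases hl : k + l ∈ B
    · simp only [Finset.sum_ite_eq, mul_ite, mul_zero, hl, if_true]; ring
    · simp [hl]
  have hbound : ‖∫ θ in (0 : ℝ)..2 * Real.pi, G θ‖ ≤
      ∫ θ in (0 : ℝ)..2 * Real.pi, D / 2 * (‖laurent A 1 (w θ)‖ ^ 2 + ‖laurent B 1 (w θ)‖ ^ 2) := by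
    refine intervalIntegral.norm_integral_le_of_norm_le Real.two_pi_pos.le
      (Eventually.of_forall fun θ _ => ?_)
      (Continuous.intervalIntegrable (by fun_prop) _ _)
    have hD : ‖laurent s c (z * w θ)‖ ≤ D := h _ (by simp [hz, hw1])
    rw [hG]
    simp only [norm_mul, RCLike.norm_conj]
    have hD0 : 0 ≤ D := (norm_nonneg _).trans hD
    set p := ‖laurent A 1 (w θ)‖
    set q := ‖laurent B 1 (w θ)‖
    have : p * q ≤ (p ^ 2 + q ^ 2) / 2 := by nlinarith [sq_nonneg (p - q)]
    calc _ ≤ D * ((p ^ 2 + q ^ 2) / 2) := by gcongr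
      _ = _ := by ring
  rw [intervalIntegral.integral_const_mul, intervalIntegral.integral_add
    (Continuous.intervalIntegrable (by fun_prop) _ _)
    (Continuous.intervalIntegrable (by fun_prop) _ _), integral_norm_sq_laurent_one,
    integral_norm_sq_laurent_one, hint, norm_mul] at hbound
  have h2 : ‖(2 * Real.pi : ℂ)‖ = 2 * Real.pi := by
    rw [norm_mul, Complex.norm_real, Real.norm_of_nonneg Real.pi_pos.le]; norm_num
  rw [h2] at hbound
  refine le_of_mul_le_mul_left (hbound.trans (le_of_eq ?_)) Real.two_pi_pos
  ring

/-- Within a dyadic block of frequencies, the projection to the positive frequencies is bounded for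
the maximum norm on the circle. -/
theorem norm_sum_Ioc_le_of_annulus {L m n : ℕ} (hL : 0 < L) (hm : L ≤ m) (hn : n ≤ 2 * L)
    (c : ℤ → ℂ) {D : ℝ} (h : ∀ z : ℂ, ‖z‖ = 1 → ‖laurent (annulus m n) c z‖ ≤ D) {z : ℂ}
    (hz : ‖z‖ = 1) : ‖∑ k ∈ Finset.Ioc m n, c k * z ^ k‖ ≤ 3 / 2 * D := by
  -- For `L < k ≤ 2 L` the translate `k + [0, L)` lies inside `[L, 3 L)`, while `-k + [0, L)` misses
  -- it. The multiplier is `L` on positive frequencies and `0` on negative ones, and `(L + 2 L) / (2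
  -- L) = 3 / 2`.
  have := norm_sum_correlation_le (annulus m n) (Finset.Ico 0 (L : ℤ))
    (Finset.Ico (L : ℤ) (3 * L)) c h hz
  have e : ∑ k ∈ annulus m n, c k * z ^ k *
      (((Finset.Ico 0 (L : ℤ)).filter fun l => k + l ∈ Finset.Ico (L : ℤ) (3 * L)).card : ℂ) =
      L * ∑ k ∈ Finset.Ioc m n, c k * z ^ k := by
    rw [sum_annulus, Finset.mul_sum]
    refine Finset.sum_congr rfl fun k hk => ?_
    have hk' := Finset.mem_Ioc.1 hk
    have f1 : (Finset.Ico 0 (L : ℤ)).filter (fun l => (k : ℤ) + l ∈ Finset.Ico (L : ℤ) (3 * L)) =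
        Finset.Ico 0 (L : ℤ) := by
      refine Finset.filter_true_of_mem fun l hl => ?_
      rw [Finset.mem_Ico] at hl ⊢; omega
    have f2 : (Finset.Ico 0 (L : ℤ)).filter
        (fun l => (-(k : ℤ)) + l ∈ Finset.Ico (L : ℤ) (3 * L)) = ∅ := by
      refine Finset.filter_false_of_mem fun l hl => ?_
      rw [Finset.mem_Ico] at hl ⊢; omega
    rw [f1, f2]
    simp [mul_comm]
  rw [e, norm_mul, Complex.norm_natCast, Int.card_Ico, Int.card_Ico] at this
  have c1 : (((L : ℤ) - 0).toNat : ℝ) = L := by simp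
  have c2 : ((3 * (L : ℤ) - L).toNat : ℝ) = 2 * L := by
    have : (3 * (L : ℤ) - L).toNat = 2 * L := by omega
    rw [this]; push_cast; ring
  rw [c1, c2] at this
  have hL' : (0 : ℝ) < L := by exact_mod_cast hL
  refine le_of_mul_le_mul_left (this.trans (le_of_eq ?_)) hL'
  ring

/-- Each half-line is isolated, then summed by parts. The negative half reduces to the positive one
by the reflection `k ↦ -k`, `z ↦ z⁻¹`. Partial sums at all intermediate `i` are needed because of
the Abel summation. -/
theorem norm_laurent_div_le {L m n : ℕ} (hL : 0 < L) (hm : L ≤ m) (hmn : m ≤ n) (hn : n ≤ 2 * L)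
    (c : ℤ → ℂ) {D : ℝ}
    (h : ∀ i, m ≤ i → i ≤ n → ∀ z : ℂ, ‖z‖ = 1 → ‖laurent (annulus m i) c z‖ ≤ D) {z : ℂ}
    (hz : ‖z‖ = 1) : ‖laurent (annulus m n) (fun k => c k / k) z‖ ≤ 3 * D / (m + 1) := by
  have refl : ∀ i (w : ℂ), laurent (annulus m i) (fun k => c (-k)) w =
      laurent (annulus m i) c w⁻¹ := by
    intro i w
    simp only [laurent, sum_annulus, neg_neg, inv_zpow', add_comm]
  have h1 : ‖∑ k ∈ Finset.Ioc m n, c k * z ^ k / k‖ ≤ 3 / 2 * D / (m + 1) :=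
    norm_sum_Ioc_div_le hmn fun i hi hin =>
      norm_sum_Ioc_le_of_annulus hL hm (hin.trans hn) c (h i hi hin) hz
  have h2 : ‖∑ k ∈ Finset.Ioc m n, c (-k) * z⁻¹ ^ k / k‖ ≤ 3 / 2 * D / (m + 1) :=
    norm_sum_Ioc_div_le hmn fun i hi hin =>
      norm_sum_Ioc_le_of_annulus hL hm (hin.trans hn) (fun k => c (-k))
        (fun w hw => by rw [refl]; exact h i hi hin _ (by simp [hw])) (by simp [hz])
  have e : laurent (annulus m n) (fun k => c k / k) z =
      ∑ k ∈ Finset.Ioc m n, c k * z ^ k / k - ∑ k ∈ Finset.Ioc m n, c (-k) * z⁻¹ ^ k / k := by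
    rw [laurent, sum_annulus, ← Finset.sum_sub_distrib]
    refine Finset.sum_congr rfl fun k _ => ?_
    push_cast
    rw [zpow_neg, zpow_natCast, inv_pow, div_neg]
    ring
  rw [e]
  refine (norm_sub_le _ _).trans ((add_le_add h1 h2).trans (le_of_eq ?_))
  ring

/-! ### Dyadic block bounds for the class `A_α` -/

theorem laurent_Icc_sub {m n : ℕ} (hmn : m ≤ n) (c : ℤ → ℂ) (z : ℂ) :
    laurent (annulus m n) c z =
      ∑ k ∈ Finset.Icc (-(n : ℤ)) n, c k * z ^ k - ∑ k ∈ Finset.Icc (-(m : ℤ)) m, c k * z ^ k := by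
  have h : ∀ i : ℕ, ∑ k ∈ Finset.Icc (-(i : ℤ)) i, c k * z ^ k =
      c 0 * z ^ (0 : ℤ) + ∑ k ∈ annulus 0 i, c k * z ^ k := fun i => by
    rw [← Icc_erase_zero]
    exact (Finset.add_sum_erase _ (fun k => c k * z ^ k) (by simp)).symm
  rw [h, h, ← sum_annulus_add (Nat.zero_le m) hmn, laurent]
  ring

/-- For `α ≤ 2`, `log n ≤ n` gives `(log n / n) ^ (2 - α) ≤ 1`, so the condition for `α` implies the
one for exponent `2`. On the block, `log n ≥ j log 2` and `n ≤ 2 * 2 ^ j`. -/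
theorem exists_norm_sum_Icc_le_of_mem_classA {α : ℝ} (hα₁ : 1 < α) (hα₂ : α ≤ 2) {b : ℤ → ℂ}
    (hb : b ∈ classA α) : ∃ C : ℝ, 0 ≤ C ∧ ∀ j n : ℕ, 1 ≤ j → 2 ^ j ≤ n → n ≤ 2 ^ (j + 1) →
      ∀ z : ℂ, ‖z‖ = 1 →
        ‖∑ k ∈ Finset.Icc (-(n : ℤ)) n, b k * z ^ k‖ ≤ C * 2 ^ j / (j : ℝ) ^ 2 := by
  obtain ⟨C, hC⟩ := hb
  have hC0 : 0 ≤ C := by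
    -- At `n = 1` the factor `(log 1) ^ α` vanishes, so the bound reads `0 ≤ C`.
    have := hC 1 le_rfl 1 (by simp)
    simpa [Real.zero_rpow (by linarith : α ≠ 0)] using this
  have hl2 : 0 < Real.log 2 := Real.log_pos (by norm_num)
  refine ⟨2 * C / Real.log 2 ^ 2, by positivity, fun j n hj hn1 hn2 z hz => ?_⟩
  have hj0 : (0 : ℝ) < j := by exact_mod_cast hj
  have hn1' : (2 : ℝ) ^ j ≤ n := by exact_mod_cast hn1
  have hn2' : (n : ℝ) ≤ 2 * 2 ^ j := by rw [← pow_succ']; exact_mod_cast hn2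
  have hn0 : (0 : ℝ) < n := lt_of_lt_of_le (by positivity) hn1'
  have hlog : j * Real.log 2 ≤ Real.log n := by
    rw [← Real.log_pow]; exact Real.log_le_log (by positivity) hn1'
  have hlog0 : 0 < Real.log n := lt_of_lt_of_le (by positivity) hlog
  have hlogn : Real.log n ≤ n := (Real.log_le_sub_one_of_pos hn0).trans (by linarith)
  set S := ‖∑ k ∈ Finset.Icc (-(n : ℤ)) n, b k * z ^ k‖ with hS
  have h := hC n (Nat.one_le_two_pow.trans hn1) z hz
  have hcmp : Real.log n ^ 2 / n ≤ Real.log n ^ α / (n : ℝ) ^ (α - 1) := by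
    have e1 : Real.log n ^ 2 = Real.log n ^ α * Real.log n ^ (2 - α) := by
      rw [← Real.rpow_add hlog0, ← Real.rpow_natCast]; congr 1; push_cast; ring
    have e2 : (n : ℝ) = (n : ℝ) ^ (α - 1) * (n : ℝ) ^ (2 - α) := by
      rw [← Real.rpow_add hn0]; ring_nf; simp
    rw [div_le_div_iff₀ hn0 (by positivity), e1]
    have : Real.log n ^ (2 - α) ≤ (n : ℝ) ^ (2 - α) :=
      Real.rpow_le_rpow hlog0.le hlogn (by linarith)
    calc Real.log n ^ α * Real.log n ^ (2 - α) * (n : ℝ) ^ (α - 1)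
        ≤ Real.log n ^ α * (n : ℝ) ^ (2 - α) * (n : ℝ) ^ (α - 1) := by gcongr
      _ = Real.log n ^ α * ((n : ℝ) ^ (α - 1) * (n : ℝ) ^ (2 - α)) := by ring
      _ = Real.log n ^ α * n := by rw [← e2]
  have h1 : Real.log n ^ 2 / n * S ≤ C :=
    le_trans (mul_le_mul_of_nonneg_right hcmp (norm_nonneg _)) h
  have h2 : (j * Real.log 2) ^ 2 * S ≤ C * n := by
    have : Real.log n ^ 2 * S ≤ C * n := by
      rw [div_mul_eq_mul_div, div_le_iff₀ hn0] at h1; exact h1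
    refine le_trans ?_ this
    gcongr
  have h3 : S ≤ C * n / (j * Real.log 2) ^ 2 := by
    rw [le_div_iff₀ (by positivity)]; linarith
  calc S ≤ C * n / (j * Real.log 2) ^ 2 := h3
    _ ≤ C * (2 * 2 ^ j) / (j * Real.log 2) ^ 2 := by gcongr
    _ = _ := by field_simp

/-- Block estimate for the modulated Hilbert transform. -/
theorem exists_norm_laurent_div_le_of_mem_classA {α : ℝ} (hα₁ : 1 < α) (hα₂ : α ≤ 2)
    {b : ℤ → ℂ} (hb : b ∈ classA α) : ∃ C : ℝ, 0 ≤ C ∧ ∀ j n : ℕ, 1 ≤ j → 2 ^ j ≤ n →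
      n ≤ 2 ^ (j + 1) → ∀ z : ℂ, ‖z‖ = 1 →
        ‖laurent (annulus (2 ^ j) n) (fun k => b k / k) z‖ ≤ C / (j : ℝ) ^ 2 := by
  obtain ⟨C, hC0, hC⟩ := exists_norm_sum_Icc_le_of_mem_classA hα₁ hα₂ hb
  refine ⟨6 * C, by positivity, fun j n hj hn1 hn2 z hz => ?_⟩
  have h2 : (2 : ℕ) ^ j ≤ 2 ^ (j + 1) := Nat.pow_le_pow_right (by norm_num) (by omega)
  have := norm_laurent_div_le (L := 2 ^ j) (by positivity) le_rfl hn1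
    (by rw [← pow_succ']; exact hn2) b (D := 2 * (C * 2 ^ j / (j : ℝ) ^ 2))
    (fun i hi hin w hw => by
      rw [laurent_Icc_sub hi]
      refine (norm_sub_le _ _).trans ?_
      linarith [hC j i hj hi (hin.trans hn2) w hw, hC j (2 ^ j) hj le_rfl h2 w hw]) hz
  refine this.trans ?_
  have hj0 : (0 : ℝ) < j := by exact_mod_cast hj
  push_cast
  rw [div_le_div_iff₀ (by positivity) (by positivity)]
  have e : 3 * (2 * (C * 2 ^ j / (j : ℝ) ^ 2)) * (j : ℝ) ^ 2 = 6 * C * 2 ^ j := by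
    field_simp; ring
  rw [e]
  nlinarith


/-! ### Twisted Koopman operators on `L²` -/

namespace MPSystem

variable (S : MPSystem.{u})

theorem iter_zero (x : S.carrier) : S.iter 0 x = x := by simp [iter]

theorem iter_add (k l : ℤ) (x : S.carrier) : S.iter (k + l) x = S.iter k (S.iter l x) := by
  simp [iter, zpow_add, Equiv.Perm.mul_apply]

theorem iter_one (x : S.carrier) : S.iter 1 x = S.T x := by simp [iter]

theorem iter_neg_one (x : S.carrier) : S.iter (-1) x = S.T.symm x := by
  simp [iter, Equiv.Perm.inv_def]

theorem measurePreserving_symm : MeasurePreserving S.T.symm S.μ S.μ :=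
  S.mp.symm S.T

theorem measurePreserving_iter (k : ℤ) : MeasurePreserving (S.iter k) S.μ S.μ := by
  induction k using Int.induction_on with
  | zero =>
    have : S.iter 0 = id := funext S.iter_zero
    rw [this]; exact MeasurePreserving.id _
  | succ k ih =>
    have : S.iter (k + 1) = S.iter k ∘ S.T := by
      ext x; rw [iter_add, iter_one]; rfl
    rw [this]; exact ih.comp S.mp
  | pred k ih =>
    have : S.iter (-(k : ℤ) - 1) = S.iter (-k) ∘ S.T.symm := by
      ext x; rw [sub_eq_add_neg, iter_add, iter_neg_one]; rfl
    rw [this]; exact ih.comp S.measurePreserving_symm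

/-- The system with the inverse transformation. -/
def symm : MPSystem.{u} where
  carrier := S.carrier
  μ := S.μ
  T := S.T.symm
  mp := S.measurePreserving_symm

theorem symm_iter (k : ℤ) (x : S.carrier) : S.symm.iter k x = S.iter (-k) x := by
  change (((S.T.symm.toEquiv : Equiv.Perm S.carrier)) ^ k) x = _
  have : (S.T.symm.toEquiv : Equiv.Perm S.carrier) = (S.T.toEquiv : Equiv.Perm S.carrier)⁻¹ := rfl
  rw [this, inv_zpow', iter]

theorem ae_iter {p : S.carrier → Prop} (h : ∀ᵐ x ∂S.μ, p x) (k : ℤ) :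
    ∀ᵐ x ∂S.μ, p (S.iter k x) :=
  (S.measurePreserving_iter k).quasiMeasurePreserving.ae h

/-- The space `L²` of the system. -/
abbrev L2 : Type u := Lp ℂ 2 S.μ

/-- The Koopman operator as a linear isometric equivalence. -/
noncomputable def koopmanEquiv : S.L2 ≃ₗᵢ[ℂ] S.L2 :=
  LinearIsometryEquiv.ofSurjective (Lp.compMeasurePreservingₗᵢ ℂ S.T S.mp) fun g => by
    refine ⟨Lp.compMeasurePreservingₗᵢ ℂ S.T.symm S.measurePreserving_symm g, ?_⟩
    refine Lp.ext ?_
    refine (Lp.coeFn_compMeasurePreserving _ S.mp).trans ?_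
    refine (S.mp.quasiMeasurePreserving.ae_eq_comp
      (Lp.coeFn_compMeasurePreserving g S.measurePreserving_symm)).trans ?_
    exact Eventually.of_forall fun x => by simp

theorem coeFn_koopmanEquiv (f : S.L2) : S.koopmanEquiv f =ᵐ[S.μ] f ∘ S.T :=
  Lp.coeFn_compMeasurePreserving f S.mp

/-- The unitary operator `f ↦ w * f ∘ T`. -/
noncomputable def koopman (w : Circle) : unitary (S.L2 →L[ℂ] S.L2) :=
  ⟨(w : ℂ) • ((Unitary.linearIsometryEquiv.symm S.koopmanEquiv : unitary _) : S.L2 →L[ℂ] S.L2), by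
    have h : (starRingEnd ℂ) (w : ℂ) * w = 1 := by
      rw [Complex.conj_mul', Circle.norm_coe]; simp
    have h' : (w : ℂ) * (starRingEnd ℂ) (w : ℂ) = 1 := by rw [mul_comm, h]
    rw [Unitary.mem_iff, star_smul]
    simp only [smul_mul_smul_comm, RCLike.star_def, h, h', one_smul]
    exact Unitary.mem_iff.1 (Subtype.property _)⟩

theorem coeFn_koopman (w : Circle) (f : S.L2) :
    (S.koopman w : S.L2 →L[ℂ] S.L2) f =ᵐ[S.μ] fun x => w * f (S.T x) := by
  refine (Lp.coeFn_smul (w : ℂ) (S.koopmanEquiv f)).trans ?_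
  filter_upwards [S.coeFn_koopmanEquiv f] with x hx
  simp [hx]

theorem coeFn_koopman_zpow (w : Circle) (k : ℤ) (f : S.L2) :
    ((S.koopman w ^ k : unitary (S.L2 →L[ℂ] S.L2)) : S.L2 →L[ℂ] S.L2) f =ᵐ[S.μ]
      fun x => (w : ℂ) ^ k * f (S.iter k x) := by
  have hw : (w : ℂ) ≠ 0 := Circle.coe_ne_zero w
  induction k using Int.induction_on with
  | zero => exact Eventually.of_forall fun x => by simp [iter_zero]
  | succ k ih =>
    have e : ((S.koopman w ^ ((k : ℤ) + 1) : unitary (S.L2 →L[ℂ] S.L2)) : S.L2 →L[ℂ] S.L2) f =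
        (S.koopman w : S.L2 →L[ℂ] S.L2)
          (((S.koopman w ^ (k : ℤ) : unitary (S.L2 →L[ℂ] S.L2)) : S.L2 →L[ℂ] S.L2) f) := by
      rw [add_comm, zpow_add, zpow_one]; rfl
    rw [e]
    filter_upwards [S.coeFn_koopman w _, S.mp.quasiMeasurePreserving.ae ih] with x h1 h2
    rw [h1, h2, iter_add, iter_one, add_comm, zpow_add₀ hw, zpow_one]
    ring
  | pred k ih =>
    set g := ((S.koopman w ^ (-(k : ℤ) - 1) : unitary (S.L2 →L[ℂ] S.L2)) : S.L2 →L[ℂ] S.L2) f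
      with hg
    have e : ((S.koopman w ^ (-(k : ℤ)) : unitary (S.L2 →L[ℂ] S.L2)) : S.L2 →L[ℂ] S.L2) f =
        (S.koopman w : S.L2 →L[ℂ] S.L2) g := by
      have : S.koopman w ^ (-(k : ℤ)) = S.koopman w * S.koopman w ^ (-(k : ℤ) - 1) := by
        rw [← zpow_one_add]; congr 1; ring
      rw [this]; rfl
    rw [e] at ih
    have h3 := (S.coeFn_koopman w g).symm.trans ih
    filter_upwards [S.measurePreserving_symm.quasiMeasurePreserving.ae h3] with x hx
    rw [S.T.apply_symm_apply] at hx
    rw [sub_eq_add_neg, iter_add, iter_neg_one, zpow_add₀ hw, zpow_neg_one,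
      mul_right_comm, ← hx]
    field_simp

theorem coeFn_laurentOp (w : Circle) (s : Finset ℤ) (c : ℤ → ℂ) (f : S.L2) :
    laurentOp (S.koopman w) s c f =ᵐ[S.μ]
      fun x => ∑ k ∈ s, c k * ((w : ℂ) ^ k * f (S.iter k x)) := by
  have e : laurentOp (S.koopman w) s c f = ∑ k ∈ s, c k •
      ((S.koopman w ^ k : unitary (S.L2 →L[ℂ] S.L2)) : S.L2 →L[ℂ] S.L2) f := by
    simp [laurentOp]
  rw [e]
  refine (Lp.coeFn_finsetSum _ _).trans ?_
  have h : ∀ᵐ x ∂S.μ, ∀ k ∈ s, (c k • ((S.koopman w ^ k : unitary (S.L2 →L[ℂ] S.L2)) :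
      S.L2 →L[ℂ] S.L2) f) x = c k * ((w : ℂ) ^ k * f (S.iter k x)) := by
    refine (ae_ball_iff s.countable_toSet).2 fun k _ => ?_
    filter_upwards [Lp.coeFn_smul (c k) (((S.koopman w ^ k : unitary (S.L2 →L[ℂ] S.L2)) :
      S.L2 →L[ℂ] S.L2) f), S.coeFn_koopman_zpow w k f] with x h1 h2
    rw [h1, Pi.smul_apply, h2, smul_eq_mul]
  filter_upwards [h] with x hx
  rw [Finset.sum_apply]
  exact Finset.sum_congr rfl hx

end MPSystem

/-! ### From summable `L²` norms to pointwise summability -/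

theorem lintegral_enorm_sq_L2 {X : Type*} [MeasurableSpace X] {μ : Measure X} (F : Lp ℂ 2 μ) :
    ∫⁻ x, ‖F x‖ₑ ^ 2 ∂μ = ENNReal.ofReal (‖F‖ ^ 2) := by
  have h := eLpNorm_nnreal_pow_eq_lintegral (μ := μ) (f := F) (p := 2) (by norm_num)
  have h2 : ENNReal.ofReal ‖F‖ = eLpNorm F 2 μ := by
    rw [Lp.norm_def, ENNReal.ofReal_toReal (Lp.eLpNorm_ne_top F)]
  rw [ENNReal.ofReal_pow (norm_nonneg _), h2]
  norm_num at h
  exact_mod_cast h.symm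

/-- By Tonelli the sum of the weighted squares has finite integral, hence is finite almost
everywhere. -/
theorem ae_summable_norm_sq {ι : Type*} [Countable ι] {X : Type*} [MeasurableSpace X]
    {μ : Measure X} (F : ι → Lp ℂ 2 μ) {w : ι → ℝ} (hw : ∀ i, 0 ≤ w i)
    (h : Summable fun i => w i * ‖F i‖ ^ 2) :
    ∀ᵐ x ∂μ, Summable fun i => w i * ‖F i x‖ ^ 2 := by
  have hm : ∀ i, AEMeasurable (fun x => ENNReal.ofReal (w i) * ‖F i x‖ₑ ^ 2) μ := fun i =>
    ((Lp.aestronglyMeasurable (F i)).enorm.pow_const 2).const_mul _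
  have hfin : ∫⁻ x, ∑' i, ENNReal.ofReal (w i) * ‖F i x‖ₑ ^ 2 ∂μ ≠ ∞ := by
    rw [lintegral_tsum hm]
    have : ∀ i, ∫⁻ x, ENNReal.ofReal (w i) * ‖F i x‖ₑ ^ 2 ∂μ =
        ENNReal.ofReal (w i * ‖F i‖ ^ 2) := fun i => by
      rw [lintegral_const_mul' _ _ ENNReal.ofReal_ne_top, lintegral_enorm_sq_L2,
        ENNReal.ofReal_mul (hw i)]
    simp_rw [this]
    exact h.tsum_ofReal_ne_top
  filter_upwards [ae_lt_top' (AEMeasurable.tsum hm) hfin] with x hx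
  have e : ∀ i, ENNReal.ofReal (w i) * ‖F i x‖ₑ ^ 2 = ENNReal.ofReal (w i * ‖F i x‖ ^ 2) :=
    fun i => by
      rw [ENNReal.ofReal_mul (hw i), ENNReal.ofReal_pow (norm_nonneg _), ofReal_norm]
  simp_rw [e] at hx
  have := ENNReal.summable_toReal hx.ne
  refine this.congr fun i => ?_
  rw [ENNReal.toReal_ofReal (mul_nonneg (hw i) (sq_nonneg _))]


/-! ### The maximal ergodic theorem -/

section Maximal

variable {X : Type*}

/-- The maximum of `0` and the Birkhoff sums of `g` of length at most `n`. -/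
def birkhoffMax (T : X → X) (g : X → ℝ) : ℕ → X → ℝ
  | 0, _ => 0
  | n + 1, x => max 0 (g x + birkhoffMax T g n (T x))

theorem birkhoffMax_nonneg (T : X → X) (g : X → ℝ) (n : ℕ) (x : X) : 0 ≤ birkhoffMax T g n x := by
  cases n with
  | zero => exact le_rfl
  | succ n => exact le_max_left _ _

theorem birkhoffMax_le_succ (T : X → X) (g : X → ℝ) (n : ℕ) (x : X) :
    birkhoffMax T g n x ≤ birkhoffMax T g (n + 1) x := by
  induction n generalizing x with
  | zero => exact birkhoffMax_nonneg T g 1 x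
  | succ n ih =>
    exact max_le_max le_rfl (by linarith [ih (T x)])

theorem birkhoffSum_le_birkhoffMax (T : X → X) (g : X → ℝ) {n N : ℕ} (h : n ≤ N) (x : X) :
    birkhoffSum T g n x ≤ birkhoffMax T g N x := by
  induction N generalizing n x with
  | zero =>
    obtain rfl : n = 0 := by omega
    simp [birkhoffMax]
  | succ N ih =>
    cases n with
    | zero => simpa using birkhoffMax_nonneg T g (N + 1) x
    | succ n =>
      rw [birkhoffSum_succ']
      exact le_max_of_le_right (by linarith [ih (n := n) (by omega) (T x)])

variable [MeasurableSpace X] {μ : Measure X}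

theorem measurable_birkhoffMax {T : X → X} (hT : Measurable T) {g : X → ℝ} (hg : Measurable g)
    (n : ℕ) : Measurable (birkhoffMax T g n) := by
  induction n with
  | zero => exact measurable_const
  | succ n ih => exact measurable_const.max (hg.add (ih.comp hT))

theorem integrable_birkhoffMax {T : X → X} (hT : MeasurePreserving T μ μ) {g : X → ℝ}
    (hg : Integrable g μ) (n : ℕ) : Integrable (birkhoffMax T g n) μ := by
  induction n with
  | zero => exact integrable_zero _ _ _
  | succ n ih => exact (integrable_zero _ _ _).sup (hg.add (hT.integrable_comp_of_integrable ih))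

/-- The maximal ergodic theorem. -/
theorem setIntegral_birkhoffMax_pos_nonneg {T : X → X} (hT : MeasurePreserving T μ μ)
    {g : X → ℝ} (hgm : Measurable g) (hg : Integrable g μ) (n : ℕ) :
    0 ≤ ∫ x in {x | 0 < birkhoffMax T g n x}, g x ∂μ := by
  set M := birkhoffMax T g n with hM
  have hMm : Measurable M := measurable_birkhoffMax hT.measurable hgm n
  have hMi : Integrable M μ := integrable_birkhoffMax hT hg n
  have hMT : Integrable (fun x => M (T x)) μ := hT.integrable_comp_of_integrable hMi
  have hA : MeasurableSet {x | 0 < M x} := measurableSet_lt measurable_const hMm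
  -- Garsia's argument: where `M > 0`, the recursion gives `g ≥ M - M ∘ T`. The integral of the
  -- right side over `{M > 0}` is nonnegative, because `M ≥ 0` vanishes off that set and `T`
  -- preserves `μ`.
  have h1 : ∀ x ∈ {x | 0 < M x}, M x - M (T x) ≤ g x := by
    intro x hx
    rw [Set.mem_ofPred_eq, hM] at hx
    cases n with
    | zero => exact absurd hx (lt_irrefl _)
    | succ n =>
      have h2 : M x = g x + birkhoffMax T g n (T x) := by
        rw [hM]
        rcases max_choice 0 (g x + birkhoffMax T g n (T x)) with h | h
        · exact absurd (hx.trans_eq h) (lt_irrefl _)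
        · exact h
      have h3 : birkhoffMax T g n (T x) ≤ M (T x) := birkhoffMax_le_succ T g n (T x)
      linarith
  have h2 : ∫ x in {x | 0 < M x}, M x ∂μ = ∫ x, M x ∂μ := by
    refine setIntegral_eq_integral_of_forall_compl_eq_zero fun x hx => ?_
    exact le_antisymm (not_lt.1 hx) (birkhoffMax_nonneg T g n x)
  have h3 : ∫ x in {x | 0 < M x}, M (T x) ∂μ ≤ ∫ x, M (T x) ∂μ :=
    setIntegral_le_integral hMT (Eventually.of_forall fun x => birkhoffMax_nonneg T g n (T x))
  have h4 : ∫ x, M (T x) ∂μ = ∫ x, M x ∂μ := by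
    have := integral_map (μ := μ) hT.measurable.aemeasurable (f := M)
      (by rw [hT.map_eq]; exact hMi.aestronglyMeasurable)
    rw [hT.map_eq] at this
    exact this.symm
  have h5 := setIntegral_mono_on (hMi.sub hMT).integrableOn hg.integrableOn hA h1
  simp only [Pi.sub_apply] at h5
  rw [integral_sub hMi.integrableOn hMT.integrableOn] at h5
  linarith

/-- Weak type `(1, 1)`, from the maximal ergodic theorem for `F - t`. -/
theorem mul_measureReal_exists_birkhoffSum_le [IsFiniteMeasure μ] {T : X → X}
    (hT : MeasurePreserving T μ μ) {F : X → ℝ} (hFm : Measurable F) (hF : Integrable F μ)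
    (hF0 : ∀ x, 0 ≤ F x) {t : ℝ} (ht : 0 ≤ t) (N : ℕ) :
    t * μ.real {x | ∃ n ≤ N, 0 < birkhoffSum T (fun y => F y - t) n x} ≤ ∫ x, F x ∂μ := by
  set g : X → ℝ := fun y => F y - t
  have hg : Integrable g μ := hF.sub (integrable_const t)
  have h := setIntegral_birkhoffMax_pos_nonneg hT (hFm.sub_const t) hg N
  set A := {x | 0 < birkhoffMax T g N x}
  have h1 : μ.real {x | ∃ n ≤ N, 0 < birkhoffSum T g n x} ≤ μ.real A :=
    measureReal_mono fun x ⟨n, hn, hx⟩ => hx.trans_le (birkhoffSum_le_birkhoffMax T g hn x)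
  rw [integral_sub hF.integrableOn (integrable_const t).integrableOn, setIntegral_const,
    smul_eq_mul] at h
  have h2 : ∫ x in A, F x ∂μ ≤ ∫ x, F x ∂μ :=
    setIntegral_le_integral hF (Eventually.of_forall hF0)
  have := mul_le_mul_of_nonneg_left h1 ht
  linarith

end Maximal

theorem integral_norm_sq_L2 {X : Type*} [MeasurableSpace X] {μ : Measure X} (F : Lp ℂ 2 μ) :
    ∫ x, ‖F x‖ ^ 2 ∂μ = ‖F‖ ^ 2 := by
  rw [integral_eq_lintegral_of_nonneg_ae (Eventually.of_forall fun x => sq_nonneg _)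
    ((Lp.aestronglyMeasurable F).norm.pow 2)]
  have : ∀ x, ENNReal.ofReal (‖F x‖ ^ 2) = ‖F x‖ₑ ^ 2 := fun x => by
    rw [ENNReal.ofReal_pow (norm_nonneg _), ofReal_norm]
  simp_rw [this]
  rw [lintegral_enorm_sq_L2, ENNReal.toReal_ofReal (sq_nonneg _)]

theorem integrable_norm_sq_L2 {X : Type*} [MeasurableSpace X] {μ : Measure X} (F : Lp ℂ 2 μ) :
    Integrable (fun x => ‖F x‖ ^ 2) μ :=
  (memLp_two_iff_integrable_sq_norm (Lp.aestronglyMeasurable F)).1 (Lp.memLp F)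

namespace MPSystem

variable (S : MPSystem.{u})

theorem iterate_eq_iter (k : ℕ) (x : S.carrier) : S.T^[k] x = S.iter k x := by
  induction k generalizing x with
  | zero => exact (S.iter_zero x).symm
  | succ k ih =>
    rw [Function.iterate_succ_apply, ih]
    push_cast
    rw [iter_add, iter_one]

/-- Weak type `(2, 2)` of the ergodic maximal function. -/
theorem measure_exists_lt_sum_norm_le (f : S.L2) {t : ℝ} (ht : 0 < t) (N : ℕ) :
    S.μ {x | ∃ n ≤ N, t * n < ∑ k ∈ Finset.range n, ‖f (S.iter k x)‖} ≤
      ENNReal.ofReal (‖f‖ ^ 2 / t ^ 2) := by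
  have h := mul_measureReal_exists_birkhoffSum_le S.mp (F := fun x => ‖f x‖ ^ 2)
    ((Lp.stronglyMeasurable f).measurable.norm.pow_const 2) (integrable_norm_sq_L2 f)
    (fun x => sq_nonneg _) (sq_nonneg t) N
  rw [integral_norm_sq_L2, mul_comm, ← le_div_iff₀ (by positivity)] at h
  refine le_trans (measure_mono ?_) ((ENNReal.le_ofReal_iff_toReal_le (measure_ne_top S.μ _)
    (by positivity)).2 h)
  rintro x ⟨n, hn, hx⟩
  refine ⟨n, hn, ?_⟩
  have e : birkhoffSum S.T (fun y => ‖f y‖ ^ 2 - t ^ 2) n x =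
      ∑ k ∈ Finset.range n, ‖f (S.iter k x)‖ ^ 2 - n * t ^ 2 := by
    rw [birkhoffSum, Finset.sum_sub_distrib]
    simp [iterate_eq_iter]
  rw [e]
  -- Cauchy–Schwarz: an average of `‖f‖` above `t` forces the average of `‖f‖ ^ 2` above `t ^ 2`,
  -- reducing to weak type `(1, 1)`.
  have hcs := sq_sum_le_card_mul_sum_sq (s := Finset.range n) (f := fun k => ‖f (S.iter k x)‖)
  rw [Finset.card_range] at hcs
  have hn0 : 0 < n := by
    rcases Nat.eq_zero_or_pos n with rfl | h0
    · simp at hx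
    · exact h0
  have hn0' : (0 : ℝ) < n := by exact_mod_cast hn0
  have h1 : (t * n) ^ 2 < n * ∑ k ∈ Finset.range n, ‖f (S.iter k x)‖ ^ 2 :=
    lt_of_lt_of_le (pow_lt_pow_left₀ hx (by positivity) (by norm_num)) hcs
  have h2 : n * (n * t ^ 2) < n * ∑ k ∈ Finset.range n, ‖f (S.iter k x)‖ ^ 2 := by
    refine lt_of_eq_of_lt ?_ h1; ring
  linarith [lt_of_mul_lt_mul_left h2 hn0'.le]

end MPSystem


/-! ### The maximal inequality for the truncated Hilbert transform -/

theorem hilbertSum_eq_sum_annulus (a : ℤ → ℂ) (S : MPSystem.{u}) (f : S.carrier → ℂ) (n : ℕ)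
    (x : S.carrier) :
    hilbertSum a S f n x = ∑ k ∈ annulus 0 n, a k * f (S.iter k x) / (k : ℂ) := by
  rw [hilbertSum, Icc_erase_zero]

theorem hilbertSum_sub_hilbertSum (a : ℤ → ℂ) (S : MPSystem.{u}) (f : S.carrier → ℂ) {m n : ℕ}
    (hmn : m ≤ n) (x : S.carrier) :
    hilbertSum a S f n x - hilbertSum a S f m x =
      ∑ k ∈ annulus m n, a k * f (S.iter k x) / (k : ℂ) := by
  rw [hilbertSum_eq_sum_annulus, hilbertSum_eq_sum_annulus,
    ← sum_annulus_add (Nat.zero_le m) hmn, add_sub_cancel_left]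

theorem norm_sum_annulus_div_le (a : ℤ → ℂ) {B : ℝ} (ha : ∀ k, ‖a k‖ ≤ B) (φ : ℤ → ℂ)
    {L m n : ℕ} (hL : 0 < L) (hLm : L ≤ m) :
    ‖∑ k ∈ annulus m n, a k * φ k / (k : ℂ)‖ ≤ B / L * ∑ k ∈ annulus m n, ‖φ k‖ := by
  have hL' : (0 : ℝ) < L := by exact_mod_cast hL
  rw [Finset.mul_sum]
  refine (norm_sum_le _ _).trans (Finset.sum_le_sum fun k hk => ?_)
  have hk' := mem_annulus.1 hk
  have hk1 : (L : ℝ) ≤ ‖(k : ℂ)‖ := by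
    rw [Complex.norm_intCast, ← Int.cast_abs, Int.abs_eq_natAbs]
    have : L ≤ k.natAbs := by omega
    exact_mod_cast this
  have hB : 0 ≤ B := (norm_nonneg _).trans (ha 0)
  rw [norm_div, norm_mul, div_mul_eq_mul_div]
  gcongr
  exact ha k

namespace MPSystem

variable (S : MPSystem.{u})

theorem measure_exists_lt_sum_norm_neg_le (f : S.L2) {t : ℝ} (ht : 0 < t) (N : ℕ) :
    S.μ {x | ∃ n ≤ N, t * n < ∑ k ∈ Finset.range n, ‖f (S.iter (-(k : ℤ)) x)‖} ≤
      ENNReal.ofReal (‖f‖ ^ 2 / t ^ 2) := by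
  have h := S.symm.measure_exists_lt_sum_norm_le f ht N
  refine (measure_mono ?_).trans h
  rintro x ⟨n, hn, hx⟩
  refine ⟨n, hn, hx.trans_eq (Finset.sum_congr rfl fun k _ => ?_)⟩
  exact congrArg (fun y => ‖f y‖) (S.symm_iter k x).symm

/-- The difference between the dyadic truncations of the Hilbert transform and the ergodic averages
of a finer truncation. -/
noncomputable def errorOp (w : Circle) (N n : ℕ) : S.L2 →L[ℂ] S.L2 :=
  cfc (fun z => hilbertSymbol N z - hilbertSymbol n z - hilbertSymbol N z * averageSymbol n z)
    (S.koopman w : S.L2 →L[ℂ] S.L2)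

/-- The truncated Hilbert transform on `L²`. -/
noncomputable def hilbertOp (w : Circle) (n : ℕ) : S.L2 →L[ℂ] S.L2 :=
  laurentOp (S.koopman w) (annulus 0 n) fun k => 1 / (k : ℂ)

theorem coeFn_hilbertOp (w : Circle) (n : ℕ) (f : S.L2) :
    S.hilbertOp w n f =ᵐ[S.μ] hilbertSum (fun k => (w : ℂ) ^ k) S f n := by
  filter_upwards [S.coeFn_laurentOp w (annulus 0 n) (fun k => 1 / (k : ℂ)) f] with x hx
  rw [hilbertOp, hx, hilbertSum_eq_sum_annulus]
  exact Finset.sum_congr rfl fun k _ => by ring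

theorem norm_hilbertOp_apply_le (w : Circle) (n : ℕ) (f : S.L2) :
    ‖S.hilbertOp w n f‖ ≤ 6 * ‖f‖ :=
  norm_laurentOp_apply_le _ _ _ (by norm_num) (fun _ hz => norm_hilbertSymbol_le hz n) f

theorem sum_norm_sq_errorOp_le (w : Circle) (J : ℕ) (f : S.L2) :
    ∑ j ∈ Finset.range (J + 1), ‖S.errorOp w (2 ^ J) (2 ^ j) f‖ ^ 2 ≤ 576 * ‖f‖ ^ 2 := by
  refine sum_norm_sq_cfc_le (S.koopman w) (Finset.range (J + 1))
    (fun j z => hilbertSymbol (2 ^ J) z - hilbertSymbol (2 ^ j) z -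
      hilbertSymbol (2 ^ J) z * averageSymbol (2 ^ j) z) (fun j _ => ?_) (by norm_num)
    (fun z hz => sum_norm_sq_error_le hz le_rfl) f
  exact ((continuousOn_laurent _ _).sub (continuousOn_laurent _ _)).sub
    ((continuousOn_laurent _ _).mul (continuousOn_laurent _ _))

theorem errorOp_eq (w : Circle) (N n : ℕ) :
    S.errorOp w N n = S.hilbertOp w N - S.hilbertOp w n -
      laurentOp (S.koopman w) ((Finset.range n).image fun k : ℕ => (k : ℤ)) (fun _ => 1 / (n : ℂ)) *
        S.hilbertOp w N := by
  have hsp := spectrum_subset_sphere (S.koopman w)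
  have c1 : ∀ s c, ContinuousOn (laurent s c) (spectrum ℂ (S.koopman w : S.L2 →L[ℂ] S.L2)) :=
    fun s c => (continuousOn_laurent s c).mono hsp
  have cH : ∀ i, ContinuousOn (hilbertSymbol i) (spectrum ℂ (S.koopman w : S.L2 →L[ℂ] S.L2)) :=
    fun i => c1 _ _
  have cA : ContinuousOn (averageSymbol n) (spectrum ℂ (S.koopman w : S.L2 →L[ℂ] S.L2)) := c1 _ _
  have hH : ∀ i, S.hilbertOp w i = cfc (hilbertSymbol i) (S.koopman w : S.L2 →L[ℂ] S.L2) :=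
    fun i => laurentOp_eq_cfc _ _ _
  have hA : laurentOp (S.koopman w) ((Finset.range n).image fun k : ℕ => (k : ℤ))
      (fun _ => 1 / (n : ℂ)) = cfc (averageSymbol n) (S.koopman w : S.L2 →L[ℂ] S.L2) :=
    laurentOp_eq_cfc _ _ _
  rw [hH, hH, hA, ← cfc_sub _ _ _ (cH N) (cH n), ← cfc_mul _ _ _ cA (cH N), errorOp,
    ← cfc_sub (fun z => hilbertSymbol N z - hilbertSymbol n z)
      (fun z => averageSymbol n z * hilbertSymbol N z) _ ((cH N).sub (cH n)) (cA.mul (cH N))]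
  simp only [mul_comm]

/-- The Cotlar-type decomposition, pointwise: `N` is kept fixed while `n` varies, so only averages
of the one function `H_N f` and the square-summable errors enter. -/
theorem ae_hilbertSum_eq (w : Circle) (N n : ℕ) (f : S.L2) :
    ∀ᵐ x ∂S.μ, hilbertSum (fun k => (w : ℂ) ^ k) S f n x = S.hilbertOp w N f x -
      1 / (n : ℂ) * ∑ k ∈ Finset.range n, (w : ℂ) ^ k * S.hilbertOp w N f (S.iter k x) -
      S.errorOp w N n f x := by
  set g := S.hilbertOp w N f with hg
  set A := laurentOp (S.koopman w) ((Finset.range n).image fun k : ℕ => (k : ℤ))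
    (fun _ => 1 / (n : ℂ)) with hA
  have e : S.hilbertOp w n f = g - A g - S.errorOp w N n f := by
    rw [errorOp_eq]
    simp only [sub_apply, ← hA, hg]
    simp only [mul_apply_eq_comp]
    abel
  have h1 : A g =ᵐ[S.μ] _ := S.coeFn_laurentOp w _ _ g
  filter_upwards [S.coeFn_hilbertOp w n f, h1, Lp.coeFn_sub (g - A g) (S.errorOp w N n f),
    Lp.coeFn_sub g (A g)] with x h1 h2 h3 h4
  rw [← h1, e, h3, Pi.sub_apply, h4, Pi.sub_apply, h2,
    Finset.sum_image (fun a _ b _ h => by simpa using h), Finset.mul_sum]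
  simp only [zpow_natCast]

theorem measure_lt_sum_norm_sq_errorOp_le (w : Circle) (J : ℕ) (f : S.L2) {t : ℝ} (ht : 0 < t) :
    S.μ {x | t ^ 2 < ∑ j ∈ Finset.range (J + 1), ‖S.errorOp w (2 ^ J) (2 ^ j) f x‖ ^ 2} ≤
      ENNReal.ofReal (576 * ‖f‖ ^ 2 / t ^ 2) := by
  set G : S.carrier → ℝ≥0∞ := fun x => ∑ j ∈ Finset.range (J + 1),
    ‖S.errorOp w (2 ^ J) (2 ^ j) f x‖ₑ ^ 2 with hG
  have hm : ∀ j, Measurable fun x => ‖S.errorOp w (2 ^ J) (2 ^ j) f x‖ₑ ^ 2 := fun j =>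
    (Lp.stronglyMeasurable _).measurable.enorm.pow_const 2
  have hGm : Measurable G := Finset.measurable_sum _ fun j _ => hm j
  have hGi : ∫⁻ x, G x ∂S.μ ≤ ENNReal.ofReal (576 * ‖f‖ ^ 2) := by
    rw [lintegral_finsetSum _ fun j _ => hm j]
    simp_rw [lintegral_enorm_sq_L2]
    rw [← ENNReal.ofReal_sum_of_nonneg fun j _ => sq_nonneg _]
    exact ENNReal.ofReal_le_ofReal (S.sum_norm_sq_errorOp_le w J f)
  have hcheb := meas_ge_le_lintegral_div (μ := S.μ) hGm.aemeasurable
    (ε := ENNReal.ofReal (t ^ 2)) (by simpa using by positivity) ENNReal.ofReal_ne_top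
  rw [ENNReal.ofReal_div_of_pos (by positivity)]
  refine (measure_mono fun x hx => ?_).trans (hcheb.trans (ENNReal.div_le_div_right hGi _))
  rw [Set.mem_ofPred_eq] at hx ⊢
  have : G x = ENNReal.ofReal (∑ j ∈ Finset.range (J + 1),
      ‖S.errorOp w (2 ^ J) (2 ^ j) f x‖ ^ 2) := by
    rw [ENNReal.ofReal_sum_of_nonneg fun j _ => sq_nonneg _]
    refine Finset.sum_congr rfl fun j _ => ?_
    rw [ENNReal.ofReal_pow (norm_nonneg _), ofReal_norm]
  rw [this]
  exact ENNReal.ofReal_le_ofReal hx.le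

/-- Pointwise control of the maximal truncated Hilbert transform. -/
theorem norm_hilbertSum_le_of_le (w : Circle) (f g E : S.carrier → ℂ) (x : S.carrier) {j n : ℕ}
    {t : ℝ} (hj : 2 ^ j ≤ n) (hn : n < 2 ^ (j + 1))
    (h : hilbertSum (fun k => (w : ℂ) ^ k) S f (2 ^ j) x = g x -
      1 / ((2 ^ j : ℕ) : ℂ) * ∑ k ∈ Finset.range (2 ^ j), (w : ℂ) ^ k * g (S.iter k x) - E x)
    (hE : ‖E x‖ ≤ t)
    (hg : ∀ i ≤ 2 ^ (j + 1), ∑ k ∈ Finset.range i, ‖g (S.iter k x)‖ ≤ t * i)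
    (hf : ∑ k ∈ Finset.range (2 ^ (j + 1)), ‖f (S.iter k x)‖ ≤ t * (2 ^ (j + 1) : ℕ))
    (hf' : ∑ k ∈ Finset.range (2 ^ (j + 1)), ‖f (S.iter (-(k : ℤ)) x)‖ ≤ t * (2 ^ (j + 1) : ℕ)) :
    ‖hilbertSum (fun k => (w : ℂ) ^ k) S f n x‖ ≤ 7 * t := by
  have hp : (0 : ℝ) < (2 : ℝ) ^ j := by positivity
  -- The average of length one is `‖g x‖` itself.
  have hg1 : ‖g x‖ ≤ t := by
    have := hg 1 Nat.one_le_two_pow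
    simpa [iter_zero] using this
  have hgA : ‖1 / ((2 ^ j : ℕ) : ℂ) * ∑ k ∈ Finset.range (2 ^ j),
      (w : ℂ) ^ k * g (S.iter k x)‖ ≤ t := by
    have h1 : ‖∑ k ∈ Finset.range (2 ^ j), (w : ℂ) ^ k * g (S.iter k x)‖ ≤ t * (2 ^ j : ℕ) := by
      refine (norm_sum_le _ _).trans (le_trans (le_of_eq ?_)
        (hg (2 ^ j) (Nat.pow_le_pow_right (by norm_num) (by omega))))
      exact Finset.sum_congr rfl fun k _ => by rw [norm_mul, norm_pow, Circle.norm_coe]; simp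
    rw [norm_mul, norm_div, norm_one, Complex.norm_natCast, one_div_mul_eq_div,
      div_le_iff₀ (by positivity)]
    exact h1
  have hdy : ‖hilbertSum (fun k => (w : ℂ) ^ k) S f (2 ^ j) x‖ ≤ 3 * t := by
    rw [h]
    refine (norm_sub_le _ _).trans ?_
    linarith [norm_sub_le (g x) (1 / ((2 ^ j : ℕ) : ℂ) * ∑ k ∈ Finset.range (2 ^ j),
      (w : ℂ) ^ k * g (S.iter k x))]
  -- No cancellation is needed past `2 ^ j`: the weights are at most `1 / 2 ^ j`, and each
  -- half-orbit of length `2 ^ (j + 1)` contributes at most `2 t`. With the `3 t` above this gives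
  -- `7 t`.
  have hsub : ‖hilbertSum (fun k => (w : ℂ) ^ k) S f n x -
      hilbertSum (fun k => (w : ℂ) ^ k) S f (2 ^ j) x‖ ≤ 4 * t := by
    rw [hilbertSum_sub_hilbertSum _ _ _ hj]
    refine (norm_sum_annulus_div_le (fun k => (w : ℂ) ^ k) (B := 1)
      (fun k => by rw [norm_zpow, Circle.norm_coe, one_zpow])
      (fun k => f (S.iter k x)) (L := 2 ^ j) (by positivity) le_rfl).trans ?_
    rw [sum_annulus, Finset.sum_add_distrib]
    have hsub : Finset.Ioc (2 ^ j) n ⊆ Finset.range (2 ^ (j + 1)) := fun k hk => by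
      rw [Finset.mem_Ioc] at hk; rw [Finset.mem_range]; omega
    have s1 := Finset.sum_le_sum_of_subset_of_nonneg hsub
      (f := fun k : ℕ => ‖f (S.iter k x)‖) fun k _ _ => norm_nonneg _
    have s2 := Finset.sum_le_sum_of_subset_of_nonneg hsub
      (f := fun k : ℕ => ‖f (S.iter (-(k : ℤ)) x)‖) fun k _ _ => norm_nonneg _
    push_cast at hf hf' ⊢
    rw [one_div_mul_eq_div, div_le_iff₀ hp]
    have e : (2 : ℝ) ^ (j + 1) = 2 * 2 ^ j := pow_succ' _ _
    rw [e] at hf hf'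
    linarith
  have := norm_add_le (hilbertSum (fun k => (w : ℂ) ^ k) S f n x -
      hilbertSum (fun k => (w : ℂ) ^ k) S f (2 ^ j) x)
      (hilbertSum (fun k => (w : ℂ) ^ k) S f (2 ^ j) x)
  rw [sub_add_cancel] at this
  linarith

/-- The bad set is covered by four: large averages of `H_N f` (giving `36 = 6 ^ 2`), large forward
or backward averages of `f` (`1` each), and a large square function (`576`). The total `614` does
not depend on `J`. -/
theorem measure_exists_lt_hilbertSum_le (w : Circle) (J : ℕ) (f : S.L2) {t : ℝ} (ht : 0 < t) :
    S.μ {x | ∃ n < 2 ^ (J + 1), 7 * t < ‖hilbertSum (fun k => (w : ℂ) ^ k) S f n x‖} ≤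
      ENNReal.ofReal (614 * ‖f‖ ^ 2 / t ^ 2) := by
  set g := S.hilbertOp w (2 ^ J) f with hg
  set A1 := {x | ∃ n ≤ 2 ^ (J + 1), t * n < ∑ k ∈ Finset.range n, ‖g (S.iter k x)‖} with hA1
  set A2 := {x | ∃ n ≤ 2 ^ (J + 1), t * n < ∑ k ∈ Finset.range n, ‖f (S.iter k x)‖} with hA2
  set A3 := {x | ∃ n ≤ 2 ^ (J + 1), t * n < ∑ k ∈ Finset.range n, ‖f (S.iter (-(k : ℤ)) x)‖}
    with hA3
  set A4 := {x | t ^ 2 < ∑ j ∈ Finset.range (J + 1), ‖S.errorOp w (2 ^ J) (2 ^ j) f x‖ ^ 2}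
    with hA4
  have m1 : S.μ A1 ≤ ENNReal.ofReal (36 * ‖f‖ ^ 2 / t ^ 2) := by
    refine (S.measure_exists_lt_sum_norm_le g ht _).trans (ENNReal.ofReal_le_ofReal ?_)
    have := S.norm_hilbertOp_apply_le w (2 ^ J) f
    rw [← hg] at this
    have h2 : ‖g‖ ^ 2 ≤ 36 * ‖f‖ ^ 2 := by nlinarith [norm_nonneg g]
    gcongr
  have m2 : S.μ A2 ≤ ENNReal.ofReal (‖f‖ ^ 2 / t ^ 2) := S.measure_exists_lt_sum_norm_le f ht _
  have m3 : S.μ A3 ≤ ENNReal.ofReal (‖f‖ ^ 2 / t ^ 2) := S.measure_exists_lt_sum_norm_neg_le f ht _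
  have m4 : S.μ A4 ≤ ENNReal.ofReal (576 * ‖f‖ ^ 2 / t ^ 2) :=
    S.measure_lt_sum_norm_sq_errorOp_le w J f ht
  have hsub : {x | ∃ n < 2 ^ (J + 1), 7 * t < ‖hilbertSum (fun k => (w : ℂ) ^ k) S f n x‖}
      ≤ᵐ[S.μ] ((A1 ∪ A2) ∪ (A3 ∪ A4) : Set S.carrier) := by
    have hae : ∀ᵐ x ∂S.μ, ∀ j : ℕ, hilbertSum (fun k => (w : ℂ) ^ k) S f (2 ^ j) x = g x -
        1 / ((2 ^ j : ℕ) : ℂ) * ∑ k ∈ Finset.range (2 ^ j), (w : ℂ) ^ k * g (S.iter k x) -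
        S.errorOp w (2 ^ J) (2 ^ j) f x :=
      ae_all_iff.2 fun j => S.ae_hilbertSum_eq w (2 ^ J) (2 ^ j) f
    filter_upwards [hae] with x hx hxm
    obtain ⟨n, hn, hlt⟩ := hxm
    by_contra hcon
    have c : (x ∉ A1 ∧ x ∉ A2) ∧ (x ∉ A3 ∧ x ∉ A4) := by
      change ¬ (x ∈ (A1 ∪ A2) ∪ (A3 ∪ A4)) at hcon
      simpa only [Set.mem_union, not_or] using hcon
    obtain ⟨⟨c1, c2⟩, c3, c4⟩ := c
    simp only [hA1, hA2, hA3, hA4, Set.mem_ofPred_eq, not_exists, not_and, not_lt] at c1 c2 c3 c4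
    rcases Nat.eq_zero_or_pos n with rfl | hn0
    · simp only [hilbertSum_eq_sum_annulus, sum_annulus, Finset.Ioc_self, Finset.sum_empty,
        norm_zero] at hlt
      linarith
    set j := Nat.log 2 n with hj
    have hj1 : 2 ^ j ≤ n := Nat.pow_log_le_self 2 hn0.ne'
    have hj2 : n < 2 ^ (j + 1) := Nat.lt_pow_succ_log_self (by norm_num) n
    have hjJ : j ≤ J := by
      have : 2 ^ j < 2 ^ (J + 1) := hj1.trans_lt hn
      have := (Nat.pow_lt_pow_iff_right (by norm_num)).1 this
      omega
    have hle : 2 ^ (j + 1) ≤ 2 ^ (J + 1) := Nat.pow_le_pow_right (by norm_num) (by omega)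
    have hE : ‖S.errorOp w (2 ^ J) (2 ^ j) f x‖ ≤ t := by
      refine le_of_sq_le_sq (le_trans ?_ c4) ht.le
      exact Finset.single_le_sum (f := fun j => ‖S.errorOp w (2 ^ J) (2 ^ j) f x‖ ^ 2)
        (fun i _ => sq_nonneg _) (Finset.mem_range.2 (by omega))
    have := S.norm_hilbertSum_le_of_le w f g (S.errorOp w (2 ^ J) (2 ^ j) f) x hj1 hj2 (hx j) hE
      (fun i hi => c1 i (hi.trans hle)) (c2 _ hle) (c3 _ hle)
    linarith
  refine (measure_mono_ae hsub).trans ((measure_union_le _ _).trans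
    ((add_le_add ((measure_union_le _ _).trans (add_le_add m1 m2))
      ((measure_union_le _ _).trans (add_le_add m3 m4))).trans (le_of_eq ?_)))
  rw [← ENNReal.ofReal_add (by positivity) (by positivity),
    ← ENNReal.ofReal_add (by positivity) (by positivity),
    ← ENNReal.ofReal_add (by positivity) (by positivity)]
  congr 1; ring

/-- Weak type `(2, 2)` of the maximal truncated ergodic Hilbert transform. -/
theorem measure_exists_lt_norm_hilbertSum_le (w : Circle) (f : S.L2) {t : ℝ} (ht : 0 < t) :
    S.μ {x | ∃ n, 7 * t < ‖hilbertSum (fun k => (w : ℂ) ^ k) S f n x‖} ≤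
      ENNReal.ofReal (614 * ‖f‖ ^ 2 / t ^ 2) := by
  have e : {x | ∃ n, 7 * t < ‖hilbertSum (fun k => (w : ℂ) ^ k) S f n x‖} = ⋃ J : ℕ,
      {x | ∃ n < 2 ^ (J + 1), 7 * t < ‖hilbertSum (fun k => (w : ℂ) ^ k) S f n x‖} := by
    ext x
    simp only [Set.mem_iUnion, Set.mem_ofPred_eq]
    refine ⟨fun ⟨n, hn⟩ => ⟨n, n, ?_, hn⟩, fun ⟨_, n, _, hn⟩ => ⟨n, hn⟩⟩
    exact Nat.lt_two_pow_self.trans (Nat.pow_lt_pow_right (by norm_num) (by omega))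
  have hmono : Monotone fun J : ℕ =>
      {x | ∃ n < 2 ^ (J + 1), 7 * t < ‖hilbertSum (fun k => (w : ℂ) ^ k) S f n x‖} := by
    intro I J hIJ x ⟨n, hn, hx⟩
    exact ⟨n, hn.trans_le (Nat.pow_le_pow_right (by norm_num) (by omega)), hx⟩
  rw [e, hmono.measure_iUnion]
  exact iSup_le fun J => S.measure_exists_lt_hilbertSum_le w J f ht

end MPSystem


/-! ### Cotlar's theorem for characters -/

theorem sum_Ioc_zero_eq_sum_range {M : Type*} [AddCommMonoid M] (F : ℕ → M) (n : ℕ) :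
    ∑ k ∈ Finset.Ioc 0 n, F k = ∑ k ∈ Finset.range n, F (k + 1) := by
  induction n with
  | zero => simp
  | succ n ih => rw [Finset.sum_Ioc_succ_top (by omega), Finset.sum_range_succ, ih]

/-- Summation by parts leaves the boundary term `ψ (n + 1) / (n + 1) → 0` and the series `∑ ψ (k +
1) / (k (k + 1))`, absolutely convergent by comparing the products with `(ψ k / k) ^ 2` and `1 / k ^
2`. -/
theorem exists_tendsto_sum_coboundary_nat {ψ : ℕ → ℂ}
    (h : Summable fun k : ℕ => 1 / (k : ℝ) ^ 2 * ‖ψ k‖ ^ 2) :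
    ∃ l, Tendsto (fun n => ∑ k ∈ Finset.Ioc 0 n, (ψ (k + 1) - ψ k) / (k : ℂ)) atTop (𝓝 l) := by
  have h0 : Tendsto (fun k : ℕ => ψ k / (k : ℂ)) atTop (𝓝 0) := by
    have h1 := h.tendsto_atTop_zero.sqrt
    rw [Real.sqrt_zero] at h1
    refine tendsto_zero_iff_norm_tendsto_zero.2 (h1.congr fun k => ?_)
    rw [norm_div, Complex.norm_natCast, one_div_mul_eq_div, ← div_pow,
      Real.sqrt_sq (by positivity)]
  have hs : Summable fun k : ℕ => ψ (k + 1 + 1) / (((k + 1 : ℕ) : ℂ) * ((k + 1 + 1 : ℕ) : ℂ)) := by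
    have s1 : Summable fun k : ℕ => 1 / ((k + 1 + 1 : ℕ) : ℝ) ^ 2 * ‖ψ (k + 1 + 1)‖ ^ 2 :=
      (summable_nat_add_iff 2).2 h
    have s2 : Summable fun k : ℕ => 1 / ((k + 1 : ℕ) : ℝ) ^ 2 :=
      (summable_nat_add_iff 1).2 (Real.summable_one_div_nat_pow.2 (by norm_num))
    refine Summable.of_norm_bounded (s1.add s2) fun k => ?_
    rw [norm_div, norm_mul, Complex.norm_natCast, Complex.norm_natCast]
    set p : ℝ := ‖ψ (k + 1 + 1)‖ / ((k + 1 + 1 : ℕ) : ℝ)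
    set q : ℝ := 1 / ((k + 1 : ℕ) : ℝ)
    have e1 : ‖ψ (k + 1 + 1)‖ / (((k + 1 : ℕ) : ℝ) * ((k + 1 + 1 : ℕ) : ℝ)) = p * q := by
      simp only [p, q]; field_simp
    have e2 : 1 / ((k + 1 + 1 : ℕ) : ℝ) ^ 2 * ‖ψ (k + 1 + 1)‖ ^ 2 = p ^ 2 := by
      simp only [p]; field_simp
    have e3 : 1 / ((k + 1 : ℕ) : ℝ) ^ 2 = q ^ 2 := by simp only [q]; field_simp
    rw [e1, e2, e3]
    nlinarith [sq_nonneg (p - q), sq_nonneg p, sq_nonneg q]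
  obtain ⟨l, hl⟩ := hs
  refine ⟨0 - ψ 1 + l, ?_⟩
  have ht := ((h0.comp (tendsto_add_atTop_nat 1)).sub_const (ψ 1)).add hl.tendsto_sum_nat
  refine ht.congr fun n => ?_
  rw [sum_Ioc_zero_eq_sum_range]
  simp only [Function.comp_apply]
  induction n with
  | zero => simp
  | succ n ih =>
    rw [Finset.sum_range_succ, Finset.sum_range_succ, ← ih]
    have h1 : ((n : ℂ) + 1) ≠ 0 := by exact_mod_cast Nat.succ_ne_zero n
    have h2 : ((n : ℂ) + 1 + 1) ≠ 0 := by exact_mod_cast Nat.succ_ne_zero (n + 1)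
    push_cast
    field_simp
    ring

theorem exists_tendsto_sum_coboundary {φ : ℤ → ℂ}
    (h : Summable fun k : ℤ => 1 / (k : ℝ) ^ 2 * ‖φ k‖ ^ 2) :
    ∃ l, Tendsto (fun n => ∑ k ∈ annulus 0 n, (φ (k + 1) - φ k) / (k : ℂ)) atTop (𝓝 l) := by
  have h1 : Summable fun k : ℕ => 1 / (k : ℝ) ^ 2 * ‖φ k‖ ^ 2 := by
    simpa [Function.comp_def] using h.comp_injective (i := fun k : ℕ => (k : ℤ)) Nat.cast_injective
  have h2 : Summable fun k : ℕ => 1 / (k : ℝ) ^ 2 * ‖φ (1 - k)‖ ^ 2 := by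
    have h3 := h.comp_injective (i := fun k : ℕ => -((k : ℤ) + 1)) fun a b hab => by
      simp at hab; omega
    refine (summable_nat_add_iff 2).1 (Summable.of_nonneg_of_le (fun k => by positivity)
      (fun k => ?_) h3)
    have e : (1 : ℤ) - ((k + 2 : ℕ) : ℤ) = -((k : ℤ) + 1) := by push_cast; ring
    rw [e, Function.comp_apply]
    push_cast
    rw [neg_sq]
    gcongr
    norm_num
  obtain ⟨l₁, hl₁⟩ := exists_tendsto_sum_coboundary_nat h1
  -- With `ψ k = φ (1 - k)`, the sign of `1 / (-k)` makes the negative half the same coboundary sum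
  -- for `ψ`.
  obtain ⟨l₂, hl₂⟩ := exists_tendsto_sum_coboundary_nat (ψ := fun k => φ (1 - k)) h2
  refine ⟨l₁ + l₂, (hl₁.add hl₂).congr fun n => ?_⟩
  rw [sum_annulus, ← Finset.sum_add_distrib]
  refine Finset.sum_congr rfl fun k _ => ?_
  have e1 : (1 : ℤ) - ((k + 1 : ℕ) : ℤ) = -k := by push_cast; ring
  have e2 : (1 : ℤ) - k = -k + 1 := by ring
  rw [e1, e2]
  push_cast
  rw [div_neg, ← sub_eq_add_neg, ← neg_sub (φ (-k + 1)), neg_div, ← sub_eq_add_neg]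

namespace MPSystem

variable (S : MPSystem.{u})

theorem hilbertSum_congr_ae (a : ℤ → ℂ) {f g : S.carrier → ℂ} (h : f =ᵐ[S.μ] g) :
    ∀ᵐ x ∂S.μ, ∀ n, hilbertSum a S f n x = hilbertSum a S g n x := by
  filter_upwards [ae_all_iff.2 fun k : ℤ => S.ae_iter h k] with x hx n
  simp only [hilbertSum, hx]

theorem hilbertSum_add (a : ℤ → ℂ) (f g : S.carrier → ℂ) (n : ℕ) (x : S.carrier) :
    hilbertSum a S (f + g) n x = hilbertSum a S f n x + hilbertSum a S g n x := by
  simp only [hilbertSum, ← Finset.sum_add_distrib, Pi.add_apply]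
  exact Finset.sum_congr rfl fun k _ => by ring

theorem hilbertSum_sub (a : ℤ → ℂ) (f g : S.carrier → ℂ) (n : ℕ) (x : S.carrier) :
    hilbertSum a S (f - g) n x = hilbertSum a S f n x - hilbertSum a S g n x := by
  simp only [hilbertSum, ← Finset.sum_sub_distrib, Pi.sub_apply]
  exact Finset.sum_congr rfl fun k _ => by ring

theorem hilbertSum_smul (a : ℤ → ℂ) (c : ℂ) (f : S.carrier → ℂ) (n : ℕ) (x : S.carrier) :
    hilbertSum a S (c • f) n x = c * hilbertSum a S f n x := by
  simp only [hilbertSum, Finset.mul_sum, Pi.smul_apply, smul_eq_mul]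
  exact Finset.sum_congr rfl fun k _ => by ring

/-- The functions in `L²` for which the modulated Hilbert transform converges almost everywhere. -/
noncomputable def convergenceSubmodule (a : ℤ → ℂ) : Submodule ℂ S.L2 where
  carrier := {f | ∀ᵐ x ∂S.μ, ∃ l, Tendsto (fun n => hilbertSum a S f n x) atTop (𝓝 l)}
  zero_mem' := by
    filter_upwards [S.hilbertSum_congr_ae a (Lp.coeFn_zero ℂ 2 S.μ)] with x hx
    refine ⟨0, tendsto_const_nhds.congr fun n => ?_⟩
    rw [hx]
    simp [hilbertSum]
  add_mem' := by
    intro f g hf hg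
    filter_upwards [hf, hg, S.hilbertSum_congr_ae a (Lp.coeFn_add f g)] with x ⟨l, hl⟩ ⟨l', hl'⟩ hx
    exact ⟨l + l', (hl.add hl').congr fun n => by rw [hx, hilbertSum_add]⟩
  smul_mem' := by
    intro c f hf
    filter_upwards [hf, S.hilbertSum_congr_ae a (Lp.coeFn_smul c f)] with x ⟨l, hl⟩ hx
    exact ⟨c * l, (hl.const_mul c).congr fun n => by rw [hx, hilbertSum_smul]⟩

theorem mem_convergenceSubmodule {a : ℤ → ℂ} {f : S.L2} : f ∈ S.convergenceSubmodule a ↔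
    ∀ᵐ x ∂S.μ, ∃ l, Tendsto (fun n => hilbertSum a S f n x) atTop (𝓝 l) := Iff.rfl

/-- Banach principle: off a set of measure at most `614 δ ^ 2 / t ^ 2`, replacing `f` by a `δ`-close
`g` with convergence changes every partial sum by at most `7 t`. The oscillation of `f` is then
eventually at most `7 t + 7 t + t = 15 t`, and `δ` is arbitrary. -/
theorem isClosed_convergenceSubmodule (w : Circle) :
    IsClosed (S.convergenceSubmodule fun k => (w : ℂ) ^ k : Set S.L2) := by
  refine isClosed_of_closure_subset fun f hf => ?_
  set a : ℤ → ℂ := fun k => (w : ℂ) ^ k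
  have key : ∀ q : ℕ, ∀ᵐ x ∂S.μ, ∃ N, ∀ n ≥ N, ∀ m ≥ N,
      ‖hilbertSum a S f n x - hilbertSum a S f m x‖ ≤ 15 * (1 / ((q : ℝ) + 1)) := by
    intro q
    set t : ℝ := 1 / ((q : ℝ) + 1)
    have ht : 0 < t := by positivity
    rw [ae_iff]
    set B := {x | ¬ ∃ N, ∀ n ≥ N, ∀ m ≥ N,
      ‖hilbertSum a S f n x - hilbertSum a S f m x‖ ≤ 15 * t} with hB
    have hδ : ∀ δ : ℝ, 0 < δ → S.μ B ≤ ENNReal.ofReal (614 * δ ^ 2 / t ^ 2) := by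
      intro δ hδ
      obtain ⟨g, hg, hfg⟩ := Metric.mem_closure_iff.1 hf δ hδ
      have hsub : B ≤ᵐ[S.μ] {x | ∃ n, 7 * t < ‖hilbertSum a S ((f - g : S.L2) : S.carrier → ℂ) n x‖} := by
        filter_upwards [S.mem_convergenceSubmodule.1 hg,
          S.hilbertSum_congr_ae a (Lp.coeFn_sub f g)] with x ⟨l, hl⟩ hx hxB
        obtain ⟨N, hN⟩ := Metric.cauchySeq_iff.1 hl.cauchySeq t ht
        by_contra hcon
        have hcon' : ∀ n, ‖hilbertSum a S f n x - hilbertSum a S g n x‖ ≤ 7 * t := by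
          intro n
          rw [← hilbertSum_sub, ← hx]
          exact not_lt.1 fun h => hcon ⟨n, h⟩
        refine hxB ⟨N, fun n hn m hm => ?_⟩
        have h1 := hN n hn m hm
        rw [dist_eq_norm] at h1
        have e : hilbertSum a S f n x - hilbertSum a S f m x =
            (hilbertSum a S f n x - hilbertSum a S g n x) -
            (hilbertSum a S f m x - hilbertSum a S g m x) +
            (hilbertSum a S g n x - hilbertSum a S g m x) := by ring
        rw [e]
        refine (norm_add_le _ _).trans ?_
        linarith [norm_sub_le (hilbertSum a S f n x - hilbertSum a S g n x)
          (hilbertSum a S f m x - hilbertSum a S g m x), hcon' n, hcon' m]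
      refine (measure_mono_ae hsub).trans
        ((S.measure_exists_lt_norm_hilbertSum_le w (f - g) ht).trans ?_)
      rw [dist_eq_norm] at hfg
      gcongr
    have hlim : Tendsto (fun n : ℕ => ENNReal.ofReal (614 * (1 / ((n : ℝ) + 1)) ^ 2 / t ^ 2)) atTop
        (𝓝 0) := by
      have := (((tendsto_one_div_add_atTop_nhds_zero_nat (𝕜 := ℝ)).pow 2).const_mul
        614).div_const (t ^ 2)
      have := ENNReal.tendsto_ofReal this
      simpa using this
    exact le_antisymm (ge_of_tendsto' hlim fun n => hδ _ (by positivity)) zero_le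
  refine S.mem_convergenceSubmodule.2 ?_
  filter_upwards [ae_all_iff.2 key] with x hx
  refine cauchySeq_tendsto_of_complete (Metric.cauchySeq_iff.2 fun ε hε => ?_)
  obtain ⟨q, hq⟩ := exists_nat_one_div_lt (show 0 < ε / 15 by positivity)
  obtain ⟨N, hN⟩ := hx q
  refine ⟨N, fun n hn m hm => ?_⟩
  rw [dist_eq_norm]
  linarith [hN n hn m hm]

theorem koopman_zpow_apply_of_fixed (w : Circle) {f : S.L2}
    (h : (S.koopman w : S.L2 →L[ℂ] S.L2) f = f) (k : ℤ) :
    ((S.koopman w ^ k : unitary (S.L2 →L[ℂ] S.L2)) : S.L2 →L[ℂ] S.L2) f = f := by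
  have hmul : ∀ (U V : unitary (S.L2 →L[ℂ] S.L2)), ((U * V : unitary (S.L2 →L[ℂ] S.L2)) :
      S.L2 →L[ℂ] S.L2) f = (U : S.L2 →L[ℂ] S.L2) ((V : S.L2 →L[ℂ] S.L2) f) := fun U V => rfl
  have hinv : (((S.koopman w)⁻¹ : unitary (S.L2 →L[ℂ] S.L2)) : S.L2 →L[ℂ] S.L2) f = f := by
    have := hmul (S.koopman w)⁻¹ (S.koopman w)
    rw [h, inv_mul_cancel] at this
    simpa using this.symm
  induction k using Int.induction_on with
  | zero => simp
  | succ k ih => rw [zpow_add_one, hmul, h, ih]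
  | pred k ih => rw [zpow_sub_one, hmul, hinv, ih]

/-- Along almost every orbit the modulated values are constant, so the symmetric sums of `1 / k`
cancel. -/
theorem mem_convergenceSubmodule_of_fixed (w : Circle) {f : S.L2}
    (h : (S.koopman w : S.L2 →L[ℂ] S.L2) f = f) :
    f ∈ S.convergenceSubmodule fun k => (w : ℂ) ^ k := by
  have h1 : ∀ᵐ x ∂S.μ, ∀ k : ℤ, (w : ℂ) ^ k * f (S.iter k x) = f x := ae_all_iff.2 fun k => by
    have := S.coeFn_koopman_zpow w k f
    rw [S.koopman_zpow_apply_of_fixed w h k] at this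
    exact this.symm
  refine S.mem_convergenceSubmodule.2 ?_
  filter_upwards [h1] with x hx
  refine ⟨0, tendsto_const_nhds.congr fun n => ?_⟩
  rw [hilbertSum_eq_sum_annulus]
  simp_rw [hx]
  rw [sum_annulus]
  refine (Finset.sum_eq_zero fun k _ => ?_).symm
  push_cast
  rw [div_neg, add_neg_cancel]

/-- Unitarity makes `∑ ‖V ^ k g‖ ^ 2 / k ^ 2` finite, which supplies the pointwise hypothesis of
`exists_tendsto_sum_coboundary`. The term `k = 0` has weight `1 / 0 = 0`. -/
theorem mem_convergenceSubmodule_coboundary (w : Circle) (g : S.L2) :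
    (S.koopman w : S.L2 →L[ℂ] S.L2) g - g ∈ S.convergenceSubmodule fun k => (w : ℂ) ^ k := by
  have hsum := ae_summable_norm_sq (μ := S.μ)
    (fun k : ℤ => ((S.koopman w ^ k : unitary (S.L2 →L[ℂ] S.L2)) : S.L2 →L[ℂ] S.L2) g)
    (w := fun k : ℤ => 1 / (k : ℝ) ^ 2) (fun k => by positivity) (by
      simp_rw [norm_unitary_apply]
      exact (Real.summable_one_div_int_pow.2 (by norm_num)).mul_right _)
  have hz := ae_all_iff.2 fun k : ℤ => S.coeFn_koopman_zpow w k g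
  have hf : ((S.koopman w : S.L2 →L[ℂ] S.L2) g - g : S.L2) =ᵐ[S.μ] fun x => w * g (S.T x) - g x := by
    filter_upwards [Lp.coeFn_sub ((S.koopman w : S.L2 →L[ℂ] S.L2) g) g, S.coeFn_koopman w g]
      with x h1 h2
    rw [h1, Pi.sub_apply, h2]
  refine S.mem_convergenceSubmodule.2 ?_
  filter_upwards [hsum, hz, S.hilbertSum_congr_ae (fun k => (w : ℂ) ^ k) hf] with x h1 h2 h3
  simp_rw [h2] at h1
  obtain ⟨l, hl⟩ := exists_tendsto_sum_coboundary h1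
  refine ⟨l, hl.congr fun n => ?_⟩
  rw [h3, hilbertSum_eq_sum_annulus]
  refine Finset.sum_congr rfl fun k _ => ?_
  rw [zpow_add_one₀ (Circle.coe_ne_zero w), add_comm k 1, iter_add, iter_one]
  ring

/-- Von Neumann's argument: a vector orthogonal to all coboundaries is fixed by `V`, so a vector
orthogonal to the subspace also lies in it. -/
theorem convergenceSubmodule_eq_top (w : Circle) :
    S.convergenceSubmodule (fun k => (w : ℂ) ^ k) = ⊤ := by
  set G := S.convergenceSubmodule fun k => (w : ℂ) ^ k with hG
  have hcomp : CompleteSpace G := (S.isClosed_convergenceSubmodule w).completeSpace_coe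
  rw [← Submodule.orthogonal_eq_bot_iff, Submodule.eq_bot_iff]
  intro f hf
  set V : S.L2 →L[ℂ] S.L2 := (S.koopman w : S.L2 →L[ℂ] S.L2) with hV
  have h0 : inner ℂ (V f - f) f = 0 :=
    (Submodule.mem_orthogonal _ _).1 hf _ (S.mem_convergenceSubmodule_coboundary w f)
  have hfix : V f = f := by
    rw [← sub_eq_zero, ← inner_self_eq_zero (𝕜 := ℂ)]
    have hVV : inner ℂ (V f) (V f) = inner ℂ f f :=
      ContinuousLinearMap.inner_map_map_of_mem_unitary (S.koopman w).2 f f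
    have h0' : inner ℂ f (V f - f) = 0 := by rw [← inner_conj_symm, h0, map_zero]
    rw [inner_sub_right, h0, sub_zero, inner_sub_left, hVV, ← neg_eq_zero, neg_sub, ← inner_sub_right, h0']
  have hfG : f ∈ G := S.mem_convergenceSubmodule_of_fixed w hfix
  exact inner_self_eq_zero.1 ((Submodule.mem_orthogonal _ _).1 hf f hfG)

/-- Cotlar's theorem in `L²` for the modulation by a character. -/
theorem goodForEHT_zpow (w : Circle) : GoodForEHT 2 (fun k => (w : ℂ) ^ k) S := by
  intro f hf
  have h : hf.toLp f ∈ S.convergenceSubmodule fun k => (w : ℂ) ^ k := by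
    rw [convergenceSubmodule_eq_top]; trivial
  filter_upwards [S.mem_convergenceSubmodule.1 h, S.hilbertSum_congr_ae _ hf.coeFn_toLp]
    with x ⟨l, hl⟩ hx
  exact ⟨l, hl.congr hx⟩

end MPSystem


/-! ### Weights with small dyadic blocks -/

theorem summable_sigma_fin_of_le {m : ℕ → ℕ} {u : (Σ j, Fin (m j)) → ℝ} {v : ℕ → ℝ}
    (hu : ∀ σ, 0 ≤ u σ) (huv : ∀ σ, u σ ≤ v σ.1) (hv : Summable fun j => m j * v j) :
    Summable u := by
  refine (summable_sigma_of_nonneg hu).2 ⟨fun j => Summable.of_finite, ?_⟩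
  refine Summable.of_nonneg_of_le (fun j => tsum_nonneg fun y => hu _) (fun j => ?_) hv
  rw [tsum_fintype]
  refine (Finset.sum_le_card_nsmul _ _ (v j) fun y _ => huv ⟨j, y⟩).trans (le_of_eq ?_)
  simp

theorem exists_forall_lt_of_summable_sigma {m : ℕ → ℕ} {u : (Σ j, Fin (m j)) → ℝ}
    (hu : Summable u) {ε : ℝ} (hε : 0 < ε) : ∃ j₀, ∀ j ≥ j₀, ∀ l, u ⟨j, l⟩ < ε := by
  have h := hu.tendsto_cofinite_zero.eventually (gt_mem_nhds hε)
  rw [eventually_cofinite] at h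
  obtain ⟨M, hM⟩ := (h.image Sigma.fst).bddAbove
  refine ⟨M + 1, fun j hj l => ?_⟩
  by_contra hcon
  have : j ≤ M := hM ⟨⟨j, l⟩, hcon, rfl⟩
  omega

/-- The mesh of the grid used inside the dyadic block of index `J`. -/
def mesh (J : ℕ) : ℕ := 2 ^ J / J ^ 2 + 1

theorem sq_le_two_mul_two_pow (J : ℕ) : J ^ 2 ≤ 2 * 2 ^ J := by
  rcases lt_or_ge J 4 with h | h
  · interval_cases J <;> norm_num
  · induction J, h using Nat.le_induction with
    | base => norm_num
    | succ J hJ ih => rw [pow_succ 2 J]; nlinarith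

/-- The mesh balances two demands: gaps of relative length `O(1 / J ^ 2)`, and at most `J ^ 2` grid
points per block. With norms `O(1 / J ^ 2)`, the squared norms then add up to `O(1 / J ^ 2)` per
block, which is summable. -/
theorem mesh_div_le {J : ℕ} (hJ : 1 ≤ J) : (mesh J : ℝ) / 2 ^ J ≤ 3 / (J : ℝ) ^ 2 := by
  have hJ0 : (0 : ℝ) < J := by exact_mod_cast hJ
  have h1 : (mesh J : ℝ) ≤ 2 ^ J / (J : ℝ) ^ 2 + 1 := by
    have : ((2 ^ J / J ^ 2 : ℕ) : ℝ) ≤ ((2 ^ J : ℕ) : ℝ) / ((J ^ 2 : ℕ) : ℝ) := Nat.cast_div_le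
    rw [mesh]
    push_cast at this ⊢
    linarith
  have h2 : (J : ℝ) ^ 2 ≤ 2 * 2 ^ J := by exact_mod_cast sq_le_two_mul_two_pow J
  rw [div_le_div_iff₀ (by positivity) (by positivity)]
  have h3 : (2 ^ J / (J : ℝ) ^ 2 + 1) * (J : ℝ) ^ 2 = 2 ^ J + (J : ℝ) ^ 2 := by field_simp
  nlinarith [mul_le_mul_of_nonneg_right h1 (sq_nonneg (J : ℝ))]

theorem two_pow_div_mesh_add_one_le {J : ℕ} (hJ : 1 ≤ J) : 2 ^ J / mesh J + 1 ≤ J ^ 2 := by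
  have : 2 ^ J < J ^ 2 * mesh J := Nat.lt_mul_div_succ _ (by positivity)
  have := Nat.div_lt_of_lt_mul (by rwa [mul_comm] at this : 2 ^ J < mesh J * J ^ 2)
  omega

namespace MPSystem

variable (S : MPSystem.{u})

/-- The block `∑ m < |k| ≤ n, b k f(T ^ k x) / k` as an operator on `L²`. -/
noncomputable def blockOp (b : ℤ → ℂ) (m n : ℕ) : S.L2 →L[ℂ] S.L2 :=
  laurentOp (S.koopman 1) (annulus m n) fun k => b k / (k : ℂ)

theorem coeFn_blockOp (b : ℤ → ℂ) {m n : ℕ} (hmn : m ≤ n) (f : S.L2) :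
    S.blockOp b m n f =ᵐ[S.μ] fun x => hilbertSum b S f n x - hilbertSum b S f m x := by
  filter_upwards [S.coeFn_laurentOp 1 (annulus m n) (fun k => b k / (k : ℂ)) f] with x hx
  rw [blockOp, hx, hilbertSum_sub_hilbertSum _ _ _ hmn]
  refine Finset.sum_congr rfl fun k _ => ?_
  rw [Circle.coe_one, one_zpow]
  ring

/-- The sum `∑ m < |k| ≤ n, f(T ^ k x)` with a constant weight as an operator on `L²`. -/
noncomputable def gapOp (r : ℝ) (m n : ℕ) : S.L2 →L[ℂ] S.L2 :=
  laurentOp (S.koopman 1) (annulus m n) fun _ => (r : ℂ)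

theorem norm_gapOp_apply_le {r : ℝ} (hr : 0 ≤ r) (m n : ℕ) (f : S.L2) :
    ‖S.gapOp r m n f‖ ≤ 2 * (n - m : ℕ) * r * ‖f‖ := by
  have e : S.gapOp r m n f = ∑ k ∈ annulus m n, (r : ℂ) •
      ((S.koopman 1 ^ k : unitary (S.L2 →L[ℂ] S.L2)) : S.L2 →L[ℂ] S.L2) f := by
    rw [gapOp, laurentOp, sum_apply]
    rfl
  have h : ∀ k : ℤ, ‖(r : ℂ) • ((S.koopman 1 ^ k : unitary (S.L2 →L[ℂ] S.L2)) :
      S.L2 →L[ℂ] S.L2) f‖ = r * ‖f‖ := fun k => by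
    rw [norm_smul, norm_unitary_apply, Complex.norm_real, Real.norm_of_nonneg hr]
  rw [e]
  refine (norm_sum_le _ _).trans (le_of_eq ?_)
  simp_rw [h]
  rw [sum_annulus, Finset.sum_const, Nat.card_Ioc, nsmul_eq_mul]
  ring

/-- The modulus of an element of `L²`. -/
noncomputable def absL2 (f : S.L2) : S.L2 :=
  MemLp.toLp (fun x => ((‖f x‖ : ℝ) : ℂ)) (Lp.memLp f).norm.ofReal

theorem coeFn_gapOp_absL2 (r : ℝ) (m n : ℕ) (f : S.L2) :
    S.gapOp r m n (S.absL2 f) =ᵐ[S.μ]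
      fun x => ((r * ∑ k ∈ annulus m n, ‖f (S.iter k x)‖ : ℝ) : ℂ) := by
  have h : S.absL2 f =ᵐ[S.μ] fun x => ((‖f x‖ : ℝ) : ℂ) := MemLp.coeFn_toLp _
  filter_upwards [S.coeFn_laurentOp 1 (annulus m n) (fun _ => (r : ℂ)) (S.absL2 f),
    ae_all_iff.2 fun k : ℤ => S.ae_iter h k] with x h1 h2
  rw [gapOp, h1]
  push_cast
  rw [Finset.mul_sum]
  refine Finset.sum_congr rfl fun k _ => ?_
  rw [h2, one_zpow, one_mul]

theorem norm_absL2 (f : S.L2) : ‖S.absL2 f‖ = ‖f‖ := by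
  rw [absL2, Lp.norm_toLp, Lp.norm_def]
  congr 1
  exact eLpNorm_congr_norm_ae (Eventually.of_forall fun x => by simp)

section Block

variable {S} {b : ℤ → ℂ} {B C : ℝ}

/-- The block norms are `O(1 / j ^ 2)`, so even the squares weighted by `j ^ 2` are summable.
Pairing with `1 / j` gives pointwise absolute convergence. -/
theorem ae_exists_tendsto_dyadic (hC : 0 ≤ C)
    (hblock : ∀ j n : ℕ, 1 ≤ j → 2 ^ j ≤ n → n ≤ 2 ^ (j + 1) → ∀ z : ℂ, ‖z‖ = 1 →
      ‖laurent (annulus (2 ^ j) n) (fun k => b k / k) z‖ ≤ C / (j : ℝ) ^ 2) (f : S.L2) :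
    ∀ᵐ x ∂S.μ, ∃ l, Tendsto (fun j => hilbertSum b S f (2 ^ (j + 1)) x) atTop (𝓝 l) := by
  have hle : ∀ j : ℕ, 2 ^ (j + 1) ≤ 2 ^ (j + 1 + 1) := fun j =>
    Nat.pow_le_pow_right (by norm_num) (by omega)
  set F : ℕ → S.L2 := fun j => S.blockOp b (2 ^ (j + 1)) (2 ^ (j + 1 + 1)) f with hF
  have hs2 : Summable fun j : ℕ => 1 / ((j + 1 : ℕ) : ℝ) ^ 2 :=
    (summable_nat_add_iff 1).2 (Real.summable_one_div_nat_pow.2 (by norm_num))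
  have hFn : ∀ j, ‖F j‖ ≤ C / ((j + 1 : ℕ) : ℝ) ^ 2 * ‖f‖ := fun j =>
    norm_laurentOp_apply_le _ _ _ (by positivity)
      (hblock (j + 1) (2 ^ (j + 1 + 1)) (by omega) (hle j) le_rfl) f
  have hsum : Summable fun j : ℕ => ((j + 1 : ℕ) : ℝ) ^ 2 * ‖F j‖ ^ 2 := by
    refine Summable.of_nonneg_of_le (fun j => by positivity) (fun j => ?_)
      (hs2.mul_left ((C * ‖f‖) ^ 2))
    calc ((j + 1 : ℕ) : ℝ) ^ 2 * ‖F j‖ ^ 2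
        ≤ ((j + 1 : ℕ) : ℝ) ^ 2 * (C / ((j + 1 : ℕ) : ℝ) ^ 2 * ‖f‖) ^ 2 := by
          gcongr; exact hFn j
      _ = _ := by field_simp
  have hx := ae_summable_norm_sq F (fun j => sq_nonneg ((j + 1 : ℕ) : ℝ)) hsum
  have hFx := ae_all_iff.2 fun j : ℕ => S.coeFn_blockOp b (hle j) f
  filter_upwards [hx, hFx] with x h1 h2
  have hs : Summable fun j => F j x := by
    refine Summable.of_norm_bounded (h1.add hs2) fun j => ?_
    set p : ℝ := ((j + 1 : ℕ) : ℝ) * ‖F j x‖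
    set q : ℝ := 1 / ((j + 1 : ℕ) : ℝ)
    have e1 : ‖F j x‖ = p * q := by simp only [p, q]; field_simp
    have e2 : ((j + 1 : ℕ) : ℝ) ^ 2 * ‖F j x‖ ^ 2 = p ^ 2 := by simp only [p]; ring
    have e3 : 1 / ((j + 1 : ℕ) : ℝ) ^ 2 = q ^ 2 := by simp only [q]; field_simp
    rw [e2, e3, e1]
    nlinarith [sq_nonneg (p - q), sq_nonneg p, sq_nonneg q]
  obtain ⟨l, hl⟩ := hs
  refine ⟨l + hilbertSum b S f (2 ^ (0 + 1)) x, ?_⟩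
  refine (hl.tendsto_sum_nat.add_const _).congr fun j => ?_
  have : ∀ i, F i x = hilbertSum b S f (2 ^ (i + 1 + 1)) x - hilbertSum b S f (2 ^ (i + 1)) x :=
    fun i => h2 i
  simp_rw [this]
  rw [Finset.sum_range_sub (fun i => hilbertSum b S f (2 ^ (i + 1)) x), sub_add_cancel]

/-- Both the increments up to the grid points and the mass in the gaps form square-summable families
in `L²`, so pointwise they tend to `0` uniformly over the grid of the block. -/
theorem ae_exists_forall_norm_sub_dyadic_lt (hb : ∀ k, ‖b k‖ ≤ B) (hC : 0 ≤ C)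
    (hblock : ∀ j n : ℕ, 1 ≤ j → 2 ^ j ≤ n → n ≤ 2 ^ (j + 1) → ∀ z : ℂ, ‖z‖ = 1 →
      ‖laurent (annulus (2 ^ j) n) (fun k => b k / k) z‖ ≤ C / (j : ℝ) ^ 2) (f : S.L2) :
    ∀ᵐ x ∂S.μ, ∀ ε > 0, ∃ j₀, ∀ j ≥ j₀, ∀ n, 2 ^ (j + 1) ≤ n → n < 2 ^ (j + 1 + 1) →
      ‖hilbertSum b S f n x - hilbertSum b S f (2 ^ (j + 1)) x‖ < ε := by
  set m : ℕ → ℕ := fun j => 2 ^ (j + 1) / mesh (j + 1) + 1 with hm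
  set p : (Σ j, Fin (m j)) → ℕ := fun σ => 2 ^ (σ.1 + 1) + σ.2 * mesh (σ.1 + 1) with hp
  set G : (Σ j, Fin (m j)) → S.L2 := fun σ => S.blockOp b (2 ^ (σ.1 + 1)) (p σ) f with hG
  -- One function of `|f|` dominates, up to the factor `B`, every partial sum ending in the gap; no
  -- maximum over `n` is needed.
  set K : (Σ j, Fin (m j)) → S.L2 := fun σ =>
    S.gapOp (1 / 2 ^ (σ.1 + 1)) (p σ) (p σ + mesh (σ.1 + 1)) (S.absL2 f) with hK
  have hp1 : ∀ σ, 2 ^ (σ.1 + 1) ≤ p σ := fun σ => Nat.le_add_right _ _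
  have hp2 : ∀ σ, p σ ≤ 2 ^ (σ.1 + 1 + 1) := fun σ => by
    have h1 : (σ.2 : ℕ) ≤ 2 ^ (σ.1 + 1) / mesh (σ.1 + 1) := Nat.lt_succ_iff.1 σ.2.2
    have h2 := (Nat.mul_le_mul_right (mesh (σ.1 + 1)) h1).trans (Nat.div_mul_le_self _ _)
    rw [pow_succ 2 (σ.1 + 1)]
    simp only [hp]
    omega
  have hs2 : ∀ A : ℝ, Summable fun j : ℕ => (m j : ℝ) * (A / ((j + 1 : ℕ) : ℝ) ^ 2) ^ 2 := by
    intro A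
    have h1 : Summable fun j : ℕ => 1 / ((j + 1 : ℕ) : ℝ) ^ 2 :=
      (summable_nat_add_iff 1).2 (Real.summable_one_div_nat_pow.2 (by norm_num))
    refine Summable.of_nonneg_of_le (fun j => by positivity) (fun j => ?_) (h1.mul_left (A ^ 2))
    have h2 : (m j : ℝ) ≤ ((j + 1 : ℕ) : ℝ) ^ 2 := by
      exact_mod_cast two_pow_div_mesh_add_one_le (J := j + 1) (by omega)
    calc (m j : ℝ) * (A / ((j + 1 : ℕ) : ℝ) ^ 2) ^ 2
        ≤ ((j + 1 : ℕ) : ℝ) ^ 2 * (A / ((j + 1 : ℕ) : ℝ) ^ 2) ^ 2 := by gcongr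
      _ = _ := by field_simp
  have hGn : ∀ σ, ‖G σ‖ ≤ C * ‖f‖ / ((σ.1 + 1 : ℕ) : ℝ) ^ 2 := fun σ => by
    refine (norm_laurentOp_apply_le _ _ _ (by positivity)
      (hblock (σ.1 + 1) (p σ) (by omega) (hp1 σ) (hp2 σ)) f).trans (le_of_eq (by ring))
  have hKn : ∀ σ, ‖K σ‖ ≤ 6 * ‖f‖ / ((σ.1 + 1 : ℕ) : ℝ) ^ 2 := fun σ => by
    refine (S.norm_gapOp_apply_le (by positivity) _ _ _).trans ?_
    rw [Nat.add_sub_cancel_left, norm_absL2]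
    have := mul_le_mul_of_nonneg_right (mesh_div_le (J := σ.1 + 1) (by omega)) (norm_nonneg f)
    calc 2 * (mesh (σ.1 + 1) : ℝ) * (1 / 2 ^ (σ.1 + 1)) * ‖f‖
        = 2 * ((mesh (σ.1 + 1) : ℝ) / 2 ^ (σ.1 + 1) * ‖f‖) := by ring
      _ ≤ 2 * (3 / ((σ.1 + 1 : ℕ) : ℝ) ^ 2 * ‖f‖) := by gcongr
      _ = _ := by ring
  have hGs : Summable fun σ => 1 * ‖G σ‖ ^ 2 := summable_sigma_fin_of_le
    (v := fun j => (C * ‖f‖ / ((j + 1 : ℕ) : ℝ) ^ 2) ^ 2) (fun σ => by positivity)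
    (fun σ => by rw [one_mul]; exact pow_le_pow_left₀ (norm_nonneg _) (hGn σ) 2) (hs2 _)
  have hKs : Summable fun σ => 1 * ‖K σ‖ ^ 2 := summable_sigma_fin_of_le
    (v := fun j => (6 * ‖f‖ / ((j + 1 : ℕ) : ℝ) ^ 2) ^ 2) (fun σ => by positivity)
    (fun σ => by rw [one_mul]; exact pow_le_pow_left₀ (norm_nonneg _) (hKn σ) 2) (hs2 _)
  have hB : 0 ≤ B := (norm_nonneg _).trans (hb 0)
  filter_upwards [ae_summable_norm_sq G (fun _ => zero_le_one) hGs,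
    ae_summable_norm_sq K (fun _ => zero_le_one) hKs,
    ae_all_iff.2 fun σ => S.coeFn_blockOp b (hp1 σ) f,
    ae_all_iff.2 fun σ : (Σ j, Fin (m j)) => S.coeFn_gapOp_absL2 (1 / 2 ^ (σ.1 + 1)) (p σ)
      (p σ + mesh (σ.1 + 1)) f] with x g1 k1 g2 k2 ε hε
  set δ : ℝ := ε / (1 + B) with hδ
  have hδ0 : 0 < δ := by positivity
  obtain ⟨j₁, h1⟩ := exists_forall_lt_of_summable_sigma g1 (show 0 < δ ^ 2 by positivity)
  obtain ⟨j₂, h2⟩ := exists_forall_lt_of_summable_sigma k1 (show 0 < δ ^ 2 by positivity)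
  refine ⟨max j₁ j₂, fun j hj n hn1 hn2 => ?_⟩
  have hmesh : 0 < mesh (j + 1) := Nat.succ_pos _
  have hl : (n - 2 ^ (j + 1)) / mesh (j + 1) < m j := by
    refine Nat.lt_succ_iff.2 (Nat.div_le_div_right ?_)
    rw [pow_succ 2 (j + 1)] at hn2
    omega
  set σ : (Σ j, Fin (m j)) := ⟨j, ⟨(n - 2 ^ (j + 1)) / mesh (j + 1), hl⟩⟩ with hσ
  have hG1 : ‖G σ x‖ < δ := by
    have := h1 j (le_trans (le_max_left _ _) hj) ⟨_, hl⟩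
    rw [one_mul] at this
    exact lt_of_pow_lt_pow_left₀ 2 hδ0.le this
  have hK1 : ‖K σ x‖ < δ := by
    have := h2 j (le_trans (le_max_right _ _) hj) ⟨_, hl⟩
    rw [one_mul] at this
    exact lt_of_pow_lt_pow_left₀ 2 hδ0.le this
  have hpn : p σ ≤ n := by
    have := Nat.div_mul_le_self (n - 2 ^ (j + 1)) (mesh (j + 1))
    simp only [hp, hσ]
    omega
  have hnp : n ≤ p σ + mesh (j + 1) := by
    have := Nat.lt_div_mul_add (a := n - 2 ^ (j + 1)) hmesh
    simp only [hp, hσ]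
    omega
  have hGx : G σ x = hilbertSum b S f (p σ) x - hilbertSum b S f (2 ^ (j + 1)) x := g2 σ
  have hKx : ‖K σ x‖ = 1 / 2 ^ (j + 1) *
      ∑ k ∈ annulus (p σ) (p σ + mesh (j + 1)), ‖f (S.iter k x)‖ := by
    have : K σ x = _ := k2 σ
    rw [this, Complex.norm_real, Real.norm_of_nonneg
      (mul_nonneg (by positivity) (Finset.sum_nonneg fun _ _ => norm_nonneg _))]
  have hrest : ‖hilbertSum b S f n x - hilbertSum b S f (p σ) x‖ ≤ B * ‖K σ x‖ := by
    rw [hilbertSum_sub_hilbertSum _ _ _ hpn, hKx]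
    refine (norm_sum_annulus_div_le b hb (fun k => f (S.iter k x)) (L := 2 ^ (j + 1))
      (by positivity) (hp1 σ)).trans ?_
    rw [← mul_assoc, mul_one_div]
    push_cast
    refine mul_le_mul_of_nonneg_left (Finset.sum_le_sum_of_subset_of_nonneg (fun k hk => ?_)
      fun _ _ _ => norm_nonneg _) (by positivity)
    rw [mem_annulus] at hk ⊢
    omega
  have e : hilbertSum b S f n x - hilbertSum b S f (2 ^ (j + 1)) x =
      G σ x + (hilbertSum b S f n x - hilbertSum b S f (p σ) x) := by rw [hGx]; ring
  rw [e]
  calc _ ≤ ‖G σ x‖ + B * ‖K σ x‖ := (norm_add_le _ _).trans (by linarith)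
    _ < δ + B * δ := by
      have := mul_le_mul_of_nonneg_left hK1.le hB
      linarith
    _ = ε := by rw [hδ]; field_simp

theorem goodForEHT_of_block_bound (hb : ∀ k, ‖b k‖ ≤ B) (hC : 0 ≤ C)
    (hblock : ∀ j n : ℕ, 1 ≤ j → 2 ^ j ≤ n → n ≤ 2 ^ (j + 1) → ∀ z : ℂ, ‖z‖ = 1 →
      ‖laurent (annulus (2 ^ j) n) (fun k => b k / k) z‖ ≤ C / (j : ℝ) ^ 2) :
    GoodForEHT 2 b S := by
  intro f hf
  filter_upwards [ae_exists_tendsto_dyadic hC hblock (hf.toLp f),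
    ae_exists_forall_norm_sub_dyadic_lt hb hC hblock (hf.toLp f),
    S.hilbertSum_congr_ae b hf.coeFn_toLp] with x ⟨l, hl⟩ h hx
  refine ⟨l, Tendsto.congr hx (Metric.tendsto_atTop.2 fun ε hε => ?_)⟩
  obtain ⟨j₁, h1⟩ := Metric.tendsto_atTop.1 hl (ε / 2) (by positivity)
  obtain ⟨j₂, h2⟩ := h (ε / 2) (by positivity)
  refine ⟨2 ^ (max j₁ j₂ + 1), fun n hn => ?_⟩
  have hn0 : n ≠ 0 := by
    rintro rfl
    exact absurd hn (not_le.2 (by positivity))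
  have hlog : max j₁ j₂ + 1 ≤ Nat.log 2 n := Nat.le_log_of_pow_le (by norm_num) hn
  obtain ⟨j, hj⟩ : ∃ j, Nat.log 2 n = j + 1 := ⟨Nat.log 2 n - 1, by omega⟩
  have a1 : 2 ^ (j + 1) ≤ n := hj ▸ Nat.pow_log_le_self 2 hn0
  have a2 : n < 2 ^ (j + 1 + 1) := hj ▸ Nat.lt_pow_succ_log_self (by norm_num) n
  have b1 := h1 j (by omega)
  have b2 := h2 j (by omega) n a1 a2
  rw [← dist_eq_norm] at b2
  linarith [dist_triangle (hilbertSum b S (hf.toLp f) n x)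
    (hilbertSum b S (hf.toLp f) (2 ^ (j + 1)) x) l]

end Block

/-! ### Linearity in the weight and conclusion -/

theorem goodForEHT_add {a b : ℤ → ℂ} (ha : GoodForEHT 2 a S) (hb : GoodForEHT 2 b S) :
    GoodForEHT 2 (a + b) S := by
  intro f hf
  filter_upwards [ha f hf, hb f hf] with x ⟨l, hl⟩ ⟨l', hl'⟩
  refine ⟨l + l', (hl.add hl').congr fun n => ?_⟩
  simp only [hilbertSum, ← Finset.sum_add_distrib, Pi.add_apply]
  exact Finset.sum_congr rfl fun k _ => by ring

theorem goodForEHT_of_mem_trigSeq {w : ℤ → ℂ} (hw : w ∈ trigSeq) : GoodForEHT 2 w S := by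
  induction hw using Submodule.span_induction with
  | mem w hw =>
    obtain ⟨z, hz, rfl⟩ := hw
    exact S.goodForEHT_zpow ⟨z, by simpa [Submonoid.unitSphere] using hz⟩
  | zero =>
    intro f _
    exact Eventually.of_forall fun x => ⟨0, by simp [hilbertSum]⟩
  | add a b _ _ ha hb => exact S.goodForEHT_add ha hb
  | smul c a _ ha =>
    intro f hf
    filter_upwards [ha f hf] with x ⟨l, hl⟩
    refine ⟨c * l, (hl.const_mul c).congr fun n => ?_⟩
    simp only [hilbertSum, Finset.mul_sum, Pi.smul_apply, smul_eq_mul]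
    exact Finset.sum_congr rfl fun k _ => by ring

end MPSystem

theorem exists_norm_le_of_mem_trigSeq {w : ℤ → ℂ} (hw : w ∈ trigSeq) : ∃ B, ∀ k, ‖w k‖ ≤ B := by
  induction hw using Submodule.span_induction with
  | mem w hw =>
    obtain ⟨z, hz, rfl⟩ := hw
    exact ⟨1, fun k => by simp [hz]⟩
  | zero => exact ⟨0, fun k => by simp⟩
  | add a b _ _ ha hb =>
    obtain ⟨A, hA⟩ := ha
    obtain ⟨B, hB⟩ := hb
    exact ⟨A + B, fun k => (norm_add_le _ _).trans (add_le_add (hA k) (hB k))⟩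
  | smul c a _ ha =>
    obtain ⟨A, hA⟩ := ha
    refine ⟨‖c‖ * A, fun k => ?_⟩
    rw [Pi.smul_apply, norm_smul]
    exact mul_le_mul_of_nonneg_left (hA k) (norm_nonneg c)

/-- Sequences of class `AB_α` are good for the ergodic Hilbert transform in `L²` of every invertible
measure preserving system. -/
theorem goodForEHT_of_mem_classAB {α : ℝ} (hα₁ : 1 < α) (hα₂ : α ≤ 2) {a : ℤ → ℂ}
    (ha : a ∈ classAB α) (S : MPSystem.{u}) : GoodForEHT 2 a S := by
  obtain ⟨hbdd, w, hw, haw⟩ := ha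
  obtain ⟨A, hA⟩ := memℓp_infty_iff.1 hbdd
  obtain ⟨W, hW⟩ := exists_norm_le_of_mem_trigSeq hw
  obtain ⟨C, hC, hblock⟩ := exists_norm_laurent_div_le_of_mem_classA hα₁ hα₂ haw
  -- The gap estimate needs `a - w` itself bounded.
  have hb : ∀ k, ‖(a - w) k‖ ≤ A + W := fun k =>
    (norm_sub_le _ _).trans (add_le_add (hA ⟨k, rfl⟩) (hW k))
  have := S.goodForEHT_add (MPSystem.goodForEHT_of_block_bound hb hC hblock)
    (S.goodForEHT_of_mem_trigSeq hw)
  rwa [sub_add_cancel] at this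

end ErgodicHilbert

theorem corollary2p5 (α : ℝ) (hα₁ : 1 < α) (hα₂ : α ≤ 2) (a : ℤ → ℂ)
    (ha : a ∈ ErgodicHilbert.classAB α) (hsymm : ∀ k : ℤ, a k = a (-k)) :
    ErgodicHilbert.UniversallyGoodForEHT 2 a ErgodicHilbert.weaklyMixingSystems.{u} := by
  exact fun S _ => ErgodicHilbert.goodForEHT_of_mem_classAB hα₁ hα₂ ha S
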